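/- All identities are between formal series in $z$ and $q$. Write $(a)_n=(a;q)_n=\prod_{0\le t<n}(1-aq^t)$ for $n\in\mathbb{Z}_{\ge 0}\cup\{\infty\}$, with the convention $1/(q)_n=0$ for $n<0$. For a triple $c=(c_0,c_1,c_2)$ of non-negative integers, a cylindric partition of profile $c$ is a triple $\Lambda=(\lambda^{(0)},\lambda^{(1)},\lambda^{(2)})$ of partitions $\lambda^{(i)}_1\ge\lambda^{(i)}_2\ge\cdots$ (eventually zero) such that $\lambda^{(0)}_j\ge\lambda^{(1)}_{j+c_1}$, $\lambda^{(1)}_j\ge\lambda^{(2)}_{j+c_2}$ and $\lambda^{(2)}_j\ge\lambda^{(0)}_{j+c_0}$ for all $j\ge 1$. Let $$F_c(z,q)=\sum_{\Lambda}z^{\max(\Lambda)}q^{\mathrm{wt}(\Lambda)},\qquad H_c(z,q)=\frac{(zq;q)_\infty}{(q;q)_\infty}F_c(z,q),$$ where the sum is over the cylindric partitions of profile $c$, $\max(\Lambda)$ is the largest part and $\mathrm{wt}(\Lambda)$ the sum of all parts. For integers $A,B,C,D$ put $$S_5(A|B)=\sum_{r,s\ge 0}\frac{z^r q^{r^2-rs+s^2+Ar+Bs+2rs}}{(q)_r(q)_s(q)_{r+s+1}},\qquad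 S_7(A|B)=\sum_{r,s\ge 0}\frac{z^r q^{r^2-rs+s^2+Ar+Bs}}{(q)_r(q)_s(q)_{r+s+1}},$$ $$S_8(A,B|C,D)=\sum_{r_1,r_2,s_1,s_2\ge 0}\frac{z^{r_1}q^{r_1^2-r_1s_1+s_1^2+r_2^2-r_2s_2+s_2^2+Ar_1+Br_2+Cs_1+Ds_2+2r_2s_2}}{(q)_{r_1-r_2}(q)_{s_1-s_2}(q)_{r_2}(q)_{s_2}(q)_{r_2+s_2+1}}.$$ **Theorem.** For every length-$3$ composition $c$ (zeros allowed) of $\ell=2$, $4$ and $5$, the series $H_c(z,q)$ is given by the following list, in which each formula also holds with $c$ replaced by any of its cyclic rotations. For $\ell=2$ (modulus $5$): $H_{(2,0,0)}=S_5(1|1)$; $H_{(1,1,0)}=S_5(0|1)$; $H_{(1,0,1)}=S_5(1|0)-q(1-z)S_5(2|1)$. For $\ell=4$ (modulus $7$): $H_{(4,0,0)}=S_7(1|1)$; $H_{(3,1,0)}=S_7(0|1)$; $H_{(3,0,1)}=S_7(1|0)-q(1-z)S_7(2|1)$; $H_{(2,1,1)}=S_7(0|0)-qS_7(1|1)$;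 $H_{(2,2,0)}=S_7(-1|1)-zS_7(1|0)$. For $\ell=5$ (modulus $8$): $H_{(5,0,0)}=S_8(1,1|1,1)$; $H_{(4,1,0)}=S_8(0,1|1,1)$; $H_{(3,2,0)}=S_8(0,0|1,1)$; $H_{(3,1,1)}=S_8(0,1|0,1)-qS_8(1,1|1,1)$; $H_{(2,2,1)}=S_8(0,0|0,1)-qS_8(0,1|1,1)$; $H_{(2,1,2)}=S_8(0,1|0,0)-qS_8(1,1|0,1)$; $H_{(4,0,1)}=S_8(1,1|0,1)-q(1-z)S_8(2,1|1,1)$; $H_{(3,0,2)}=S_8(1,1|0,0)-q(1-z)S_8(2,1|0,1)$. (For the cyclically equivalent profiles $(1,1,0),(1,0,1)$, and likewise for $(2,2,1),(2,1,2)$, both expressions are valid.) -/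

import Mathlib

open scoped PowerSeries

namespace CylPart

noncomputable section

/-! ### Cylindric partitions -/

/-- Cylindric partitions of rank `d + 1` and profile `c = (c_0, …, c_d)`: sequences of `d + 1`
partitions `lam i` (weakly decreasing, eventually zero; the `j`-th part is `lam i (j - 1)`) with
`lam^(i)_j ≥ lam^(i+1)_(j + c_(i+1))`.  Indices are cyclic, so that `i = d` gives
`lam^(d)_j ≥ lam^(0)_(j + c_0)`. -/
structure CylindricPartition {d : ℕ} (c : Fin (d + 1) → ℕ) where
  lam : Fin (d + 1) → ℕ → ℕ
  antitone : ∀ i, Antitone (lam i)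
  eventually_zero : ∀ i, ∃ N, ∀ j, N ≤ j → lam i j = 0
  interlace : ∀ i j, lam (i + 1) (j + c (i + 1)) ≤ lam i j

/-- The largest part occurring in a cylindric partition. -/
def CylindricPartition.max {d : ℕ} {c : Fin (d + 1) → ℕ} (L : CylindricPartition c) : ℕ :=
  Finset.univ.sup fun i => L.lam i 0

/-- The sum of all parts of a cylindric partition. -/
def CylindricPartition.weight {d : ℕ} {c : Fin (d + 1) → ℕ} (L : CylindricPartition c) : ℕ :=
  ∑ i, ∑ᶠ j, L.lam i j

/-! ### The ring of series

Identities live in `ℚ((q))[[z]]`, that is, power series in `z` (the variable `PowerSeries.X` of the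
outer ring) over formal Laurent series in `q`. -/

/-- Formal power series in `z` whose coefficients are formal Laurent series in `q`. -/
abbrev ZQ : Type := PowerSeries (LaurentSeries ℚ)

/-- A power series in `q`, viewed as a Laurent series in `q`. -/
def toLaurent : ℚ⟦X⟧ →+* LaurentSeries ℚ := HahnSeries.ofPowerSeries ℤ ℚ

/-- The variable `q`. -/
def q : ZQ := PowerSeries.C (HahnSeries.single (1 : ℤ) (1 : ℚ))

/-- The variable `z`. -/
def z : ZQ := PowerSeries.X

/-- `(q)_n = (1 - q)(1 - q^2)⋯(1 - q^n)`. -/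
def qPoch (n : ℕ) : ℚ⟦X⟧ := ∏ t ∈ Finset.range n, (1 - PowerSeries.X ^ (t + 1))

/-- `1 / (q)_n`, with the usual convention that it is `0` for `n < 0`. -/
def qPochInv (n : ℤ) : ℚ⟦X⟧ := if n < 0 then 0 else (qPoch n.toNat)⁻¹

/-- `(q)_∞ = ∏_{t ≥ 1} (1 - q^t)`: the factors with `t > m` do not affect the coefficient of
`q^m`. -/
def qPochInf : ℚ⟦X⟧ := PowerSeries.mk fun m => PowerSeries.coeff m (qPoch m)

/-- `(zq; q)_n = (1 - zq)(1 - zq^2)⋯(1 - zq^n)`, in `ℚ[[q]][[z]]`. -/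
def zqPoch (n : ℕ) : PowerSeries ℚ⟦X⟧ :=
  ∏ t ∈ Finset.range n, (1 - PowerSeries.X * PowerSeries.C (PowerSeries.X ^ (t + 1)))

/-- `(zq; q)_∞ = ∏_{t ≥ 1} (1 - z q^t)`: the factors with `t > m` do not affect the coefficient of
`z^n q^m`. -/
def zqPochInf : PowerSeries ℚ⟦X⟧ :=
  PowerSeries.mk fun n => PowerSeries.mk fun m =>
    PowerSeries.coeff m (PowerSeries.coeff n (zqPoch m))

/-- `F_c(z, q) = ∑_Λ z^(max Λ) q^(weight Λ)`, the sum being over all cylindric partitions `Λ` of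
profile `c`. -/
def F {d : ℕ} (c : Fin (d + 1) → ℕ) : PowerSeries ℚ⟦X⟧ :=
  PowerSeries.mk fun n => PowerSeries.mk fun m =>
    (Nat.card {L : CylindricPartition c // L.max = n ∧ L.weight = m} : ℚ)

/-- `H_c(z, q) = (zq; q)_∞ / (q)_∞ · F_c(z, q)`. -/
def H {d : ℕ} (c : Fin (d + 1) → ℕ) : ZQ :=
  PowerSeries.map toLaurent (zqPochInf * PowerSeries.C qPochInf⁻¹ * F c)

/-! ### Infinite sums -/

theorem le_of_coeff_ne_zero {a m : ℤ} {P : ℚ⟦X⟧}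
    (h : (HahnSeries.single a (1 : ℚ) * toLaurent P).coeff m ≠ 0) : a ≤ m := by
  by_contra hlt
  apply h
  rw [HahnSeries.coeff_single_mul, one_mul]
  exact (PowerSeries.coeff_coe P (m - a)).trans (if_pos (by omega))

/-- The family `q^(e i) · P i` of Laurent series, where every set `{i | e i ≤ m}` is finite. -/
def qFamily {ι : Type} (e : ι → ℤ) (P : ι → ℚ⟦X⟧) (he : ∀ m : ℤ, {i | e i ≤ m}.Finite) :
    HahnSeries.SummableFamily ℤ ℚ ι where
  toFun i := HahnSeries.single (e i) (1 : ℚ) * toLaurent (P i)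
  isPWO_iUnion_support' := by
    obtain ⟨b, hb⟩ : BddBelow (e '' {i | e i ≤ 0}) := ((he 0).image e).bddBelow
    refine (BddBelow.isWF ⟨min b 0, ?_⟩).isPWO
    rintro m hm
    obtain ⟨i, hi⟩ := Set.mem_iUnion.mp hm
    have hle := le_of_coeff_ne_zero hi
    rcases le_total (e i) 0 with h | h
    · exact (min_le_left _ _).trans ((hb ⟨i, h, rfl⟩).trans hle)
    · exact (min_le_right _ _).trans (h.trans hle)
  finite_co_support' m := (he m).subset fun _ hi => le_of_coeff_ne_zero hi

/-- The formal sum `∑_i q^(e i) · P i`. -/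
def qSum {ι : Type} (e : ι → ℤ) (P : ι → ℚ⟦X⟧) (he : ∀ m : ℤ, {i | e i ≤ m}.Finite) :
    LaurentSeries ℚ :=
  (qFamily e P he).hsum

theorem quad_lower (b : ℤ) (s : ℕ) : -b ^ 2 ≤ (s : ℤ) ^ 2 + b * s := by
  nlinarith [sq_nonneg (2 * (s : ℤ) + b), sq_nonneg b]

theorem quad_finite (b m : ℤ) : {s : ℕ | (s : ℤ) ^ 2 + b * s ≤ m}.Finite := by
  refine (Set.finite_Iic (m.natAbs + b.natAbs)).subset fun s hs => ?_
  simp only [Set.mem_ofPred_eq, Set.mem_Iic] at hs ⊢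
  by_contra h
  have h1 : |m| + |b| + 1 ≤ (s : ℤ) := by
    have := Int.natCast_natAbs m
    have := Int.natCast_natAbs b
    omega
  nlinarith [le_abs_self m, neg_abs_le b, abs_nonneg m, abs_nonneg b]

/-! ### The sums of Andrews--Schilling--Warnaar type -/

/-- Exponent of `q` in the sum `S5`. -/
def exp5 (A B : ℤ) (r s : ℕ) : ℤ :=
  r ^ 2 - r * s + s ^ 2 + A * r + B * s + 2 * r * s

theorem exp5_finite (A B : ℤ) (r : ℕ) (m : ℤ) : {s | exp5 A B r s ≤ m}.Finite := by
  refine (quad_finite (B + r) (m - r ^ 2 - A * r)).subset fun s hs => ?_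
  simp only [Set.mem_ofPred_eq, exp5] at hs ⊢
  linarith

/-- `S_5(A | B) = ∑_{r, s ≥ 0} z^r q^(r^2 - r s + s^2 + A r + B s + 2 r s) /
((q)_r (q)_s (q)_(r + s + 1))`. -/
def S5 (A B : ℤ) : ZQ := PowerSeries.mk fun r =>
  qSum (exp5 A B r) (fun s => qPochInv r * qPochInv s * qPochInv (r + s + 1)) (exp5_finite A B r)

/-- Exponent of `q` in the sum `S7`. -/
def exp7 (A B : ℤ) (r s : ℕ) : ℤ :=
  r ^ 2 - r * s + s ^ 2 + A * r + B * s

theorem exp7_finite (A B : ℤ) (r : ℕ) (m : ℤ) : {s | exp7 A B r s ≤ m}.Finite := by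
  refine (quad_finite (B - r) (m - r ^ 2 - A * r)).subset fun s hs => ?_
  simp only [Set.mem_ofPred_eq, exp7] at hs ⊢
  linarith

/-- `S_7(A | B) = ∑_{r, s ≥ 0} z^r q^(r^2 - r s + s^2 + A r + B s) /
((q)_r (q)_s (q)_(r + s + 1))`. -/
def S7 (A B : ℤ) : ZQ := PowerSeries.mk fun r =>
  qSum (exp7 A B r) (fun s => qPochInv r * qPochInv s * qPochInv (r + s + 1)) (exp7_finite A B r)

/-- Exponent of `q` in the sum `S8`; the index is `x = (r₂, s₁, s₂)`. -/
def exp8 (A B C D : ℤ) (r₁ : ℕ) (x : ℕ × ℕ × ℕ) : ℤ :=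
  (r₁ ^ 2 - r₁ * x.2.1 + x.2.1 ^ 2) + (x.1 ^ 2 - x.1 * x.2.2 + x.2.2 ^ 2) +
    A * r₁ + B * x.1 + C * x.2.1 + D * x.2.2 + 2 * x.1 * x.2.2

theorem exp8_finite (A B C D : ℤ) (r₁ : ℕ) (m : ℤ) : {x | exp8 A B C D r₁ x ≤ m}.Finite := by
  refine ((quad_finite B (m - r₁ ^ 2 - A * r₁ + B ^ 2 + (C - r₁) ^ 2 + D ^ 2)).prod
    ((quad_finite (C - r₁) (m - r₁ ^ 2 - A * r₁ + B ^ 2 + (C - r₁) ^ 2 + D ^ 2)).prod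
      (quad_finite D (m - r₁ ^ 2 - A * r₁ + B ^ 2 + (C - r₁) ^ 2 + D ^ 2)))).subset ?_
  rintro ⟨r₂, s₁, s₂⟩ hx
  simp only [Set.mem_ofPred_eq, exp8, Set.mem_prod] at hx ⊢
  have h1 := quad_lower B r₂
  have h2 := quad_lower (C - r₁) s₁
  have h3 := quad_lower D s₂
  have h4 : (0 : ℤ) ≤ r₂ * s₂ := by positivity
  have h5 := sq_nonneg B
  have h6 := sq_nonneg (C - r₁)
  have h7 := sq_nonneg D
  refine ⟨?_, ?_, ?_⟩ <;> linarith

/-- `S_8(A, B | C, D)`, the sum over `r₁, r₂, s₁, s₂ ≥ 0` of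
`z^r₁ q^(r₁^2 - r₁ s₁ + s₁^2 + r₂^2 - r₂ s₂ + s₂^2 + A r₁ + B r₂ + C s₁ + D s₂ + 2 r₂ s₂) /
((q)_(r₁ - r₂) (q)_(s₁ - s₂) (q)_r₂ (q)_s₂ (q)_(r₂ + s₂ + 1))`, where the terms with `r₁ < r₂` or
`s₁ < s₂` vanish. -/
def S8 (A B C D : ℤ) : ZQ := PowerSeries.mk fun r₁ =>
  qSum (exp8 A B C D r₁)
    (fun x => qPochInv (r₁ - x.1) * qPochInv (x.2.1 - x.2.2) *
      (qPochInv x.1 * qPochInv x.2.2 * qPochInv (x.1 + x.2.2 + 1)))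
    (exp8_finite A B C D r₁)

/-- The cyclic rotation `(c_j, c_(j+1), c_(j+2))` of `c = (c_0, c_1, c_2)`. -/
def rot (c : Fin 3 → ℕ) (j : Fin 3) : Fin 3 → ℕ := fun i => c (i + j)

end

end CylPart

open CylPart

namespace CylPart

/-! The plan is to show that both sides solve the same system of q-difference equations in `z` with
the same constant term, and that such a solution is unique. Combinatorial side. Let `G c` count
cylindric partitions with all parts at most `n`, so that `F c` is `(1 - z) * G c`. In a partition
with parts at most `n`, delete the first parts equal to `n` at a set `J` of positions with positive
`c i`. The weight drops by `n * J.card` and the profile changes to `removeProfile c J`.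
Inclusion–exclusion over `J` gives `sum_σ_iterate_G`, a form of the Corteel–Welsh equations, where
`σ` is `z ↦ z q`. Multiplication by the prefactor of `H` absorbs the denominators, because that
prefactor changes by the factor `1 - z q` under `σ`. In rank 3 there are three shapes of equation:
`H_succ_zero_zero`, `H_succ_succ_zero` and `H_succ_succ_succ`. Series side. Raising one summation
index by 1 and expanding the factors released from the inverse Pochhammer symbols gives linear
relations among the sums with shifted parameters (`S5_rel`, `z_mul_S5` and their analogues). Since
`σ` only raises the parameter `A`, each equation of the system becomes a linear identity among such
sums. It is either trivial or an explicit combination of these relations (the lemmas `S5_funeq₁₁₀`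
to `S8_funeq₂₁₂`). Uniqueness. In every equation the right side involves only series to which `σ`
has been applied. On the coefficient of `z^n`, `n ≥ 1`, this multiplies by at least `q^n`, so a
solution with zero constant term has coefficients of arbitrarily high order in `q` and vanishes
(`eq_zero_of_shiftSpan`). Constant terms. On the combinatorial side the constant term is `1 /
(q)_∞`. For the sums it follows from a Durfee-type identity (`coeff_zero_S5_one`), a
`q`-Chu–Vandermonde summation (`sum_qpow_pinv`) and the linear relations once more. -/

/-! ### Formal sums of Laurent series -/

/-- The family `f` of Laurent series is summable, with sum `a`. -/
def QHasSum {ι : Type} (f : ι → LaurentSeries ℚ) (a : LaurentSeries ℚ) : Prop :=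
  ∃ G : HahnSeries.SummableFamily ℤ ℚ ι, (∀ i, G i = f i) ∧ G.hsum = a

section QHasSum

variable {ι : Type} {f g : ι → LaurentSeries ℚ} {a b : LaurentSeries ℚ}

theorem QHasSum.unique (hf : QHasSum f a) (hg : QHasSum f b) : a = b := by
  obtain ⟨G, hG, rfl⟩ := hf
  obtain ⟨G', hG', rfl⟩ := hg
  rw [HahnSeries.SummableFamily.ext fun i => (hG i).trans (hG' i).symm]

theorem QHasSum.congr (hf : QHasSum f a) (h : ∀ i, f i = g i) : QHasSum g a := by
  obtain ⟨G, hG, rfl⟩ := hf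
  exact ⟨G, fun i => (hG i).trans (h i), rfl⟩

theorem QHasSum.add (hf : QHasSum f a) (hg : QHasSum g b) :
    QHasSum (fun i => f i + g i) (a + b) := by
  obtain ⟨G, hG, rfl⟩ := hf
  obtain ⟨G', hG', rfl⟩ := hg
  exact ⟨G + G', fun i => by simp [hG, hG'], HahnSeries.SummableFamily.hsum_add⟩

theorem QHasSum.sub (hf : QHasSum f a) (hg : QHasSum g b) :
    QHasSum (fun i => f i - g i) (a - b) := by
  obtain ⟨G, hG, rfl⟩ := hf
  obtain ⟨G', hG', rfl⟩ := hg
  exact ⟨G - G', fun i => by simp [hG, hG'], HahnSeries.SummableFamily.hsum_sub⟩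

theorem QHasSum.mul_left (c : LaurentSeries ℚ) (hf : QHasSum f a) :
    QHasSum (fun i => c * f i) (c * a) := by
  obtain ⟨G, hG, rfl⟩ := hf
  exact ⟨c • G, fun i => congrArg (c * ·) (hG i), HahnSeries.SummableFamily.hsum_smul⟩

theorem QHasSum.zero : QHasSum (fun _ : ι => 0) 0 :=
  ⟨0, fun _ => rfl, HahnSeries.SummableFamily.hsum_zero⟩

/-- Reindexing along an injection, with zeros outside of its range. -/
theorem QHasSum.shift (hf : QHasSum f a) (φ : ι → ι) (hφ : Function.Injective φ)
    (h : ∀ i, g (φ i) = f i) (h0 : ∀ i, i ∉ Set.range φ → g i = 0) : QHasSum g a := by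
  obtain ⟨G, hG, rfl⟩ := hf
  refine ⟨G.embDomain ⟨φ, hφ⟩, fun i => ?_, HahnSeries.SummableFamily.hsum_embDomain _ _⟩
  by_cases hi : i ∈ Set.range φ
  · obtain ⟨j, rfl⟩ := hi
    rw [h, ← hG]
    exact HahnSeries.SummableFamily.embDomain_image G ⟨φ, hφ⟩
  · rw [h0 i hi]
    exact HahnSeries.SummableFamily.embDomain_of_notMem_range G ⟨φ, hφ⟩ hi

theorem QHasSum.coeff (hf : QHasSum f a) (m : ℤ) : a.coeff m = ∑ᶠ i, (f i).coeff m := by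
  obtain ⟨G, hG, rfl⟩ := hf
  simp only [← hG]
  exact HahnSeries.SummableFamily.coeff_hsum

theorem QHasSum.finite_support (hf : QHasSum f a) (m : ℤ) :
    (Function.support fun i => (f i).coeff m).Finite := by
  obtain ⟨G, hG, rfl⟩ := hf
  simp only [← hG]
  exact G.finite_co_support m

end QHasSum

theorem qHasSum_qSum {ι : Type} (e : ι → ℤ) (P : ι → ℚ⟦X⟧) (he : ∀ m : ℤ, {i | e i ≤ m}.Finite) :
    QHasSum (fun i => HahnSeries.single (e i) (1 : ℚ) * toLaurent (P i)) (qSum e P he) :=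
  ⟨qFamily e P he, fun _ => rfl, rfl⟩

/-! ### Powers of `q` and inverse `q`-Pochhammer symbols -/

/-- `q ^ n` as a Laurent series. -/
noncomputable def qpow (n : ℤ) : LaurentSeries ℚ := HahnSeries.single n 1

theorem qpow_add (a b : ℤ) : qpow (a + b) = qpow a * qpow b := by
  simp [qpow, HahnSeries.single_mul_single]

theorem qpow_zero : qpow 0 = 1 := rfl

theorem qpow_natCast (n : ℕ) : qpow n = toLaurent (PowerSeries.X ^ n) := by
  simp [qpow, toLaurent, HahnSeries.ofPowerSeries_X_pow]

/-- `1 / (q)_n` as a Laurent series. -/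
noncomputable def pinv (n : ℤ) : LaurentSeries ℚ := toLaurent (qPochInv n)

theorem pinv_of_neg {n : ℤ} (h : n < 0) : pinv n = 0 := by
  simp [pinv, qPochInv, h]

theorem constantCoeff_qPoch (n : ℕ) : PowerSeries.constantCoeff (qPoch n) = 1 := by
  simp [qPoch, map_prod]

theorem qPoch_mul_inv (n : ℕ) : qPoch n * (qPoch n)⁻¹ = 1 :=
  PowerSeries.mul_inv_cancel _ (by simp [constantCoeff_qPoch])

theorem pinv_natCast (n : ℕ) : pinv n = toLaurent (qPoch n)⁻¹ := by
  rw [pinv, qPochInv, if_neg (by omega), Int.toNat_natCast]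

theorem pinv_zero : pinv 0 = 1 := by
  have := pinv_natCast 0
  simpa [qPoch] using this

/-- Valid for every integer: at `n = 0` the factor `1 - q^0` vanishes, in agreement with the
convention for negative indices. This is why the index shifts below need no case distinction in
terms such as `r₁ - r₂`. -/
theorem pinv_sub_one (n : ℤ) : pinv (n - 1) = (1 - qpow n) * pinv n := by
  rcases lt_trichotomy n 0 with h | rfl | h
  · rw [pinv_of_neg h, pinv_of_neg (by omega), mul_zero]
  · rw [pinv_of_neg (by omega), qpow_zero, sub_self, zero_mul]
  · obtain ⟨k, rfl⟩ : ∃ k : ℕ, n = (k + 1 : ℕ) := ⟨(n - 1).toNat, by omega⟩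
    have e : ((k + 1 : ℕ) : ℤ) - 1 = k := by push_cast; ring
    rw [e, pinv_natCast, pinv_natCast, qpow_natCast, ← map_one toLaurent, ← map_sub, ← map_mul]
    congr 1
    have h1 : qPoch (k + 1) = qPoch k * (1 - PowerSeries.X ^ (k + 1)) := Finset.prod_range_succ ..
    have h2 := qPoch_mul_inv k
    have h3 := qPoch_mul_inv (k + 1)
    rw [h1] at h3 ⊢
    linear_combination (-(qPoch k)⁻¹) * h3 +
      (1 - PowerSeries.X ^ (k + 1)) * (qPoch k * (1 - PowerSeries.X ^ (k + 1)))⁻¹ * h2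

/-- The index `n + 1` enters through two equations, so that differently cast forms of it can be used
on the right. -/
theorem pinv_eq {n m k : ℤ} (hm : m = n + 1) (hk : k = n + 1) :
    pinv n = (1 - qpow m) * pinv k := by
  rw [hk, ← hm, ← pinv_sub_one, hm, add_sub_cancel_right]

/-! ### The coefficients of the sums -/

theorem hasSum5 (A B : ℤ) (r : ℕ) :
    QHasSum (fun s : ℕ => qpow (exp5 A B r s) * (pinv r * pinv s * pinv (r + s + 1)))
      (PowerSeries.coeff r (S5 A B)) := by
  rw [S5, PowerSeries.coeff_mk]
  exact (qHasSum_qSum _ _ _).congr fun s => by simp only [map_mul]; rfl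

theorem hasSum7 (A B : ℤ) (r : ℕ) :
    QHasSum (fun s : ℕ => qpow (exp7 A B r s) * (pinv r * pinv s * pinv (r + s + 1)))
      (PowerSeries.coeff r (S7 A B)) := by
  rw [S7, PowerSeries.coeff_mk]
  exact (qHasSum_qSum _ _ _).congr fun s => by simp only [map_mul]; rfl

theorem hasSum8 (A B C D : ℤ) (r : ℕ) :
    QHasSum (fun x : ℕ × ℕ × ℕ => qpow (exp8 A B C D r x) *
      (pinv (r - x.1) * pinv (x.2.1 - x.2.2) * (pinv x.1 * pinv x.2.2 * pinv (x.1 + x.2.2 + 1))))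
      (PowerSeries.coeff r (S8 A B C D)) := by
  rw [S8, PowerSeries.coeff_mk]
  exact (qHasSum_qSum _ _ _).congr fun s => by simp only [map_mul]; rfl

/-! ### Powers of `q` and the substitution `z ↦ z q` in the ring of series -/

/-- `q ^ n` as an element of `ZQ`. -/
noncomputable def qz (n : ℤ) : ZQ := PowerSeries.C (qpow n)

theorem qz_add (a b : ℤ) : qz (a + b) = qz a * qz b := by
  simp [qz, qpow_add]

theorem qz_natCast (n : ℕ) : qz n = q ^ n := by
  induction n with
  | zero => simp [qz, qpow_zero]
  | succ k ih => rw [pow_succ, ← ih, Nat.cast_succ, qz_add]; rfl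

theorem coeff_qz_mul (a : ℤ) (f : ZQ) (r : ℕ) :
    PowerSeries.coeff r (qz a * f) = qpow a * PowerSeries.coeff r f := by
  simp [qz]

theorem coeff_q_mul (f : ZQ) (r : ℕ) :
    PowerSeries.coeff r (q * f) = qpow 1 * PowerSeries.coeff r f := coeff_qz_mul 1 f r

theorem coeff_z_mul_zero (f : ZQ) : PowerSeries.coeff 0 (z * f) = 0 := by
  simp [z]

theorem coeff_z_mul_succ (f : ZQ) (r : ℕ) :
    PowerSeries.coeff (r + 1) (z * f) = PowerSeries.coeff r f := by
  simp [z, PowerSeries.coeff_succ_X_mul]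

/-- Clearing negative powers of `q`. -/
theorem q_pow_mul_of_eq {x y : ZQ} {b : ℤ} (h : x = qz (1 - b) * y) (e e' : ℕ)
    (he : (e' : ℤ) = e + 1 - b) : q ^ e * x = q ^ e' * y := by
  rw [h, ← qz_natCast e, ← qz_natCast e', he, add_sub_assoc, qz_add, mul_assoc]

/-- The substitution `z ↦ z q`. -/
noncomputable def σ : ZQ →+* ZQ := PowerSeries.rescale (qpow 1)

theorem qpow_pow (a : ℤ) (n : ℕ) : qpow a ^ n = qpow (n * a) := by
  induction n with
  | zero => simp [qpow_zero]
  | succ k ih => rw [pow_succ, ih, ← qpow_add]; congr 1; push_cast; ring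

theorem coeff_σ (f : ZQ) (r : ℕ) :
    PowerSeries.coeff r (σ f) = qpow r * PowerSeries.coeff r f := by
  rw [σ, PowerSeries.coeff_rescale, qpow_pow, mul_one]

theorem σ_q : σ q = q := by
  ext1 r
  rw [coeff_σ]
  rcases r with _ | r <;> simp [q, PowerSeries.coeff_C, qpow_zero]

theorem σ_z : σ z = z * q := by
  ext1 r
  rw [coeff_σ, mul_comm z q, coeff_q_mul, z, PowerSeries.coeff_X]
  split_ifs with h
  · subst h; simp
  · simp

/-- The factor `q^r` that `z ↦ z q` puts on the coefficient of `z^r` is absorbed into `A * r`. Thus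
`σ` never leaves the family of sums. -/
theorem σ_S5 (A B : ℤ) : σ (S5 A B) = S5 (A + 1) B := by
  ext1 r
  rw [coeff_σ]
  refine ((hasSum5 A B r).mul_left _).unique ((hasSum5 (A + 1) B r).congr fun s => ?_)
  symm
  rw [← mul_assoc, ← qpow_add]
  congr 2
  simp only [exp5]; ring

theorem σ_S7 (A B : ℤ) : σ (S7 A B) = S7 (A + 1) B := by
  ext1 r
  rw [coeff_σ]
  refine ((hasSum7 A B r).mul_left _).unique ((hasSum7 (A + 1) B r).congr fun s => ?_)
  symm
  rw [← mul_assoc, ← qpow_add]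
  congr 2
  simp only [exp7]; ring

theorem σ_S8 (A B C D : ℤ) : σ (S8 A B C D) = S8 (A + 1) B C D := by
  ext1 r
  rw [coeff_σ]
  refine ((hasSum8 A B C D r).mul_left _).unique ((hasSum8 (A + 1) B C D r).congr fun s => ?_)
  symm
  rw [← mul_assoc, ← qpow_add]
  congr 2
  simp only [exp8]; ring

/-! ### Linear relations between the sums -/

/-- Rewriting the denominators at `s` by those at `s + 1` releases `(1 - q^(s+1)) (1 - q^(r+s+2))`,
whose four terms are the four sums on the right. The terms with `s = 0` on the right cancel in
pairs, since there the second parameter plays no role. -/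
theorem S5_rel (a b : ℤ) : S5 a b = qz (1 - b) *
    (S5 (a - 1) (b - 2) - S5 (a - 1) (b - 1) - q * S5 a (b - 1) + q * S5 a b) := by
  ext1 r
  simp only [coeff_qz_mul, coeff_q_mul, map_add, map_sub]
  refine ((hasSum5 a b r).shift Nat.succ Nat.succ_injective (fun k => ?_) fun k hk => ?_).unique
    (((((hasSum5 _ _ r).sub (hasSum5 _ _ r)).sub ((hasSum5 _ _ r).mul_left _)).add
    ((hasSum5 _ _ r).mul_left _)).mul_left _)
  · have h1 : qpow (1 - b) * qpow (exp5 (a - 1) (b - 2) r k.succ) = qpow (exp5 a b r k) := by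
      simp only [← qpow_add]; congr 1; simp only [exp5]; push_cast; ring
    have h2 : qpow (1 - b) * qpow (exp5 (a - 1) (b - 1) r k.succ) =
        qpow (exp5 a b r k) * qpow (k + 1) := by
      simp only [← qpow_add]; congr 1; simp only [exp5]; push_cast; ring
    have h3 : qpow (1 - b) * (qpow 1 * qpow (exp5 a (b - 1) r k.succ)) =
        qpow (exp5 a b r k) * qpow (r + k + 2) := by
      simp only [← qpow_add]; congr 1; simp only [exp5]; push_cast; ring
    have h4 : qpow (1 - b) * (qpow 1 * qpow (exp5 a b r k.succ)) =
        qpow (exp5 a b r k) * (qpow (k + 1) * qpow (r + k + 2)) := by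
      simp only [← qpow_add]; congr 1; simp only [exp5]; push_cast; ring
    have p1 : pinv k = (1 - qpow (k + 1)) * pinv k.succ := pinv_eq rfl (by push_cast; ring)
    have p2 : pinv (r + k + 1) = (1 - qpow (r + k + 2)) * pinv (r + k.succ + 1) :=
      pinv_eq (by ring) (by push_cast; ring)
    rw [p1, p2]
    linear_combination (pinv r * pinv k.succ * pinv (r + k.succ + 1)) * (h1 - h2 - h3 + h4)
  · obtain rfl : k = 0 := by
      rcases k with _ | k
      · rfl
      · exact absurd ⟨k, rfl⟩ hk
    simp [exp5]

/-- The same device applied to the index `r`; the shift of `r` is what multiplication by `z` does.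
At `r = 0` the right side cancels because the first parameter plays no role. -/
theorem z_mul_S5 (a b : ℤ) : z * S5 a b = qz (1 - a) *
    (S5 (a - 2) (b - 1) - S5 (a - 1) (b - 1) - q * S5 (a - 1) b + q * S5 a b) := by
  ext1 r
  simp only [coeff_qz_mul, coeff_q_mul, map_add, map_sub]
  have key := (((((hasSum5 (a - 2) (b - 1) r).sub (hasSum5 (a - 1) (b - 1) r)).sub
    ((hasSum5 (a - 1) b r).mul_left (qpow 1))).add ((hasSum5 a b r).mul_left (qpow 1))).mul_left
    (qpow (1 - a)))
  rcases r with _ | r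
  · rw [coeff_z_mul_zero]
    refine QHasSum.zero.unique (key.congr fun k => ?_)
    simp [exp5]
  rw [coeff_z_mul_succ]
  refine (hasSum5 a b r).unique (key.congr fun k => ?_)
  have h1 : qpow (1 - a) * qpow (exp5 (a - 2) (b - 1) (r + 1) k) = qpow (exp5 a b r k) := by
      simp only [← qpow_add]; congr 1; simp only [exp5]; push_cast; ring
  have h2 : qpow (1 - a) * qpow (exp5 (a - 1) (b - 1) (r + 1) k) =
      qpow (exp5 a b r k) * qpow (r + 1) := by
      simp only [← qpow_add]; congr 1; simp only [exp5]; push_cast; ring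
  have h3 : qpow (1 - a) * (qpow 1 * qpow (exp5 (a - 1) b (r + 1) k)) =
      qpow (exp5 a b r k) * qpow (r + k + 2) := by
      simp only [← qpow_add]; congr 1; simp only [exp5]; push_cast; ring
  have h4 : qpow (1 - a) * (qpow 1 * qpow (exp5 a b (r + 1) k)) =
      qpow (exp5 a b r k) * (qpow (r + 1) * qpow (r + k + 2)) := by
      simp only [← qpow_add]; congr 1; simp only [exp5]; push_cast; ring
  have p1 : pinv r = (1 - qpow (r + 1)) * pinv (r + 1 : ℕ) := pinv_eq rfl (by push_cast; ring)
  have p2 : pinv (r + k + 1) = (1 - qpow (r + k + 2)) * pinv ((r + 1 : ℕ) + k + 1) :=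
    pinv_eq (by ring) (by push_cast; ring)
  rw [p1, p2]
  linear_combination (pinv (r + 1 : ℕ) * pinv k * pinv ((r + 1 : ℕ) + k + 1)) * (h1 - h2 - h3 + h4)

theorem S7_rel (a b : ℤ) : S7 a b = qz (1 - b) *
    (S7 (a + 1) (b - 2) - S7 (a + 1) (b - 1) - q * S7 (a + 2) (b - 1) + q * S7 (a + 2) b) := by
  ext1 r
  simp only [coeff_qz_mul, coeff_q_mul, map_add, map_sub]
  refine ((hasSum7 a b r).shift Nat.succ Nat.succ_injective (fun k => ?_) fun k hk => ?_).unique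
    (((((hasSum7 _ _ r).sub (hasSum7 _ _ r)).sub ((hasSum7 _ _ r).mul_left _)).add
    ((hasSum7 _ _ r).mul_left _)).mul_left _)
  · have h1 : qpow (1 - b) * qpow (exp7 (a + 1) (b - 2) r k.succ) = qpow (exp7 a b r k) := by
      simp only [← qpow_add]; congr 1; simp only [exp7]; push_cast; ring
    have h2 : qpow (1 - b) * qpow (exp7 (a + 1) (b - 1) r k.succ) =
        qpow (exp7 a b r k) * qpow (k + 1) := by
      simp only [← qpow_add]; congr 1; simp only [exp7]; push_cast; ring
    have h3 : qpow (1 - b) * (qpow 1 * qpow (exp7 (a + 2) (b - 1) r k.succ)) =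
        qpow (exp7 a b r k) * qpow (r + k + 2) := by
      simp only [← qpow_add]; congr 1; simp only [exp7]; push_cast; ring
    have h4 : qpow (1 - b) * (qpow 1 * qpow (exp7 (a + 2) b r k.succ)) =
        qpow (exp7 a b r k) * (qpow (k + 1) * qpow (r + k + 2)) := by
      simp only [← qpow_add]; congr 1; simp only [exp7]; push_cast; ring
    have p1 : pinv k = (1 - qpow (k + 1)) * pinv k.succ := pinv_eq rfl (by push_cast; ring)
    have p2 : pinv (r + k + 1) = (1 - qpow (r + k + 2)) * pinv (r + k.succ + 1) :=
      pinv_eq (by ring) (by push_cast; ring)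
    rw [p1, p2]
    linear_combination (pinv r * pinv k.succ * pinv (r + k.succ + 1)) * (h1 - h2 - h3 + h4)
  · obtain rfl : k = 0 := by
      rcases k with _ | k
      · rfl
      · exact absurd ⟨k, rfl⟩ hk
    simp [exp7]

theorem z_mul_S7 (a b : ℤ) : z * S7 a b = qz (1 - a) *
    (S7 (a - 2) (b + 1) - S7 (a - 1) (b + 1) - q * S7 (a - 1) (b + 2) + q * S7 a (b + 2)) := by
  ext1 r
  simp only [coeff_qz_mul, coeff_q_mul, map_add, map_sub]
  have key := (((((hasSum7 (a - 2) (b + 1) r).sub (hasSum7 (a - 1) (b + 1) r)).sub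
    ((hasSum7 (a - 1) (b + 2) r).mul_left (qpow 1))).add ((hasSum7 a (b + 2) r).mul_left (qpow
        1))).mul_left
    (qpow (1 - a)))
  rcases r with _ | r
  · rw [coeff_z_mul_zero]
    refine QHasSum.zero.unique (key.congr fun k => ?_)
    simp [exp7]
  rw [coeff_z_mul_succ]
  refine (hasSum7 a b r).unique (key.congr fun k => ?_)
  have h1 : qpow (1 - a) * qpow (exp7 (a - 2) (b + 1) (r + 1) k) = qpow (exp7 a b r k) := by
      simp only [← qpow_add]; congr 1; simp only [exp7]; push_cast; ring
  have h2 : qpow (1 - a) * qpow (exp7 (a - 1) (b + 1) (r + 1) k) =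
      qpow (exp7 a b r k) * qpow (r + 1) := by
      simp only [← qpow_add]; congr 1; simp only [exp7]; push_cast; ring
  have h3 : qpow (1 - a) * (qpow 1 * qpow (exp7 (a - 1) (b + 2) (r + 1) k)) =
      qpow (exp7 a b r k) * qpow (r + k + 2) := by
      simp only [← qpow_add]; congr 1; simp only [exp7]; push_cast; ring
  have h4 : qpow (1 - a) * (qpow 1 * qpow (exp7 a (b + 2) (r + 1) k)) =
      qpow (exp7 a b r k) * (qpow (r + 1) * qpow (r + k + 2)) := by
      simp only [← qpow_add]; congr 1; simp only [exp7]; push_cast; ring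
  have p1 : pinv r = (1 - qpow (r + 1)) * pinv (r + 1 : ℕ) := pinv_eq rfl (by push_cast; ring)
  have p2 : pinv (r + k + 1) = (1 - qpow (r + k + 2)) * pinv ((r + 1 : ℕ) + k + 1) :=
    pinv_eq (by ring) (by push_cast; ring)
  rw [p1, p2]
  linear_combination (pinv (r + 1 : ℕ) * pinv k * pinv ((r + 1 : ℕ) + k + 1)) * (h1 - h2 - h3 + h4)

/-- Only `(q)_(r₁-r₂)` depends on `r₁`, so the shift of `r₁` releases one factor and two terms
suffice. At `r₁ = 0` only `r₂ = 0` survives, and the two sums agree there. -/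
theorem z_mul_S8 (a b c d : ℤ) : z * S8 a b c d =
    qz (1 - a) * (S8 (a - 2) b (c + 1) d - S8 (a - 1) (b - 1) (c + 1) d) := by
  ext1 r
  simp only [coeff_qz_mul, map_sub]
  have key := (((hasSum8 (a - 2) b (c + 1) d r).sub
    (hasSum8 (a - 1) (b - 1) (c + 1) d r)).mul_left (qpow (1 - a)))
  rcases r with _ | r
  · rw [coeff_z_mul_zero]
    refine QHasSum.zero.unique (key.congr fun ⟨u, v, w⟩ => ?_)
    rcases u with _ | u
    · simp [exp8]
    · rw [pinv_of_neg (n := ((0 : ℕ) : ℤ) - (u + 1 : ℕ)) (by push_cast; omega)]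
      simp
  rw [coeff_z_mul_succ]
  refine (hasSum8 a b c d r).unique (key.congr fun ⟨u, v, w⟩ => ?_)
  have h1 : qpow (1 - a) * qpow (exp8 (a - 2) b (c + 1) d (r + 1) (u, v, w)) =
      qpow (exp8 a b c d r (u, v, w)) := by
      simp only [← qpow_add]; congr 1; simp only [exp8]; push_cast; ring
  have h2 : qpow (1 - a) * qpow (exp8 (a - 1) (b - 1) (c + 1) d (r + 1) (u, v, w)) =
      qpow (exp8 a b c d r (u, v, w)) * qpow (r - u + 1) := by
      simp only [← qpow_add]; congr 1; simp only [exp8]; push_cast; ring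
  have p1 : pinv (r - u) = (1 - qpow (r - u + 1)) * pinv ((r + 1 : ℕ) - u) :=
    pinv_eq rfl (by push_cast; ring)
  simp only [p1]
  linear_combination (pinv ((r + 1 : ℕ) - u) * pinv (v - w) *
    (pinv u * pinv w * pinv (u + w + 1))) * (h1 - h2)

/-- The shift of `s₁` touches only `(q)_(s₁-s₂)`. The boundary terms `s₁ = 0` force `s₂ = 0`, where
the two sums on the right agree. -/
theorem S8_rel_s₁ (a b c d : ℤ) : S8 a b c d =
    qz (1 - c) * (S8 (a + 1) b (c - 2) d - S8 (a + 1) b (c - 1) (d - 1)) := by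
  ext1 r
  simp only [coeff_qz_mul, map_sub]
  refine ((hasSum8 a b c d r).shift (fun x => (x.1, x.2.1 + 1, x.2.2))
    (fun x y h => ?_) (fun ⟨u, v, w⟩ => ?_) fun ⟨u, v, w⟩ hk => ?_).unique
    (((hasSum8 _ _ _ _ r).sub (hasSum8 _ _ _ _ r)).mul_left _)
  · simp only [Prod.mk.injEq, add_left_inj] at h
    exact Prod.ext h.1 (Prod.ext h.2.1 h.2.2)
  · have h1 : qpow (1 - c) * qpow (exp8 (a + 1) b (c - 2) d r (u, v + 1, w)) =
        qpow (exp8 a b c d r (u, v, w)) := by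
      simp only [← qpow_add]; congr 1; simp only [exp8]; push_cast; ring
    have h2 : qpow (1 - c) * qpow (exp8 (a + 1) b (c - 1) (d - 1) r (u, v + 1, w)) =
        qpow (exp8 a b c d r (u, v, w)) * qpow (v - w + 1) := by
      simp only [← qpow_add]; congr 1; simp only [exp8]; push_cast; ring
    have p1 : pinv (v - w) = (1 - qpow (v - w + 1)) * pinv ((v + 1 : ℕ) - w) :=
      pinv_eq rfl (by push_cast; ring)
    simp only [p1]
    linear_combination (pinv (r - u) * pinv ((v + 1 : ℕ) - w) *
      (pinv u * pinv w * pinv (u + w + 1))) * (h1 - h2)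
  · obtain rfl : v = 0 := by
      rcases v with _ | v
      · rfl
      · exact absurd ⟨(u, v, w), rfl⟩ hk
    rcases w with _ | w
    · simp [exp8]
    · rw [pinv_of_neg (n := ((0 : ℕ) : ℤ) - (w + 1 : ℕ)) (by push_cast; omega)]
      simp

/-- Raising `r₂` lowers `r₁ - r₂`, which costs a factor `1 - q^(r₁-r₂)`. The difference on the left
supplies exactly this factor; the right side comes from `(q)_r₂` and `(q)_(r₂+s₂+1)` as before. -/
theorem S8_rel_r₂ (a b c d : ℤ) : S8 a b c d - S8 (a + 1) (b - 1) c d =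
    qz (1 - b) * (S8 a (b - 2) c (d - 1) - S8 a (b - 1) c (d - 1) - q * S8 a (b - 1) c d +
      q * S8 a b c d) := by
  ext1 r
  simp only [coeff_qz_mul, coeff_q_mul, map_add, map_sub]
  refine (((hasSum8 a b c d r).sub (hasSum8 (a + 1) (b - 1) c d r)).shift
    (fun x => (x.1 + 1, x.2.1, x.2.2))
    (fun x y h => ?_) (fun ⟨u, v, w⟩ => ?_) fun ⟨u, v, w⟩ hk => ?_).unique
    (((((hasSum8 _ _ _ _ r).sub (hasSum8 _ _ _ _ r)).sub ((hasSum8 _ _ _ _ r).mul_left _)).add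
    ((hasSum8 _ _ _ _ r).mul_left _)).mul_left _)
  · simp only [Prod.mk.injEq, add_left_inj] at h
    exact Prod.ext h.1 (Prod.ext h.2.1 h.2.2)
  · have h0 : qpow (exp8 (a + 1) (b - 1) c d r (u, v, w)) =
        qpow (exp8 a b c d r (u, v, w)) * qpow (r - u) := by
      simp only [← qpow_add]; congr 1; simp only [exp8]; ring
    have h1 : qpow (1 - b) * qpow (exp8 a (b - 2) c (d - 1) r (u + 1, v, w)) =
        qpow (exp8 a b c d r (u, v, w)) := by
      simp only [← qpow_add]; congr 1; simp only [exp8]; push_cast; ring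
    have h2 : qpow (1 - b) * qpow (exp8 a (b - 1) c (d - 1) r (u + 1, v, w)) =
        qpow (exp8 a b c d r (u, v, w)) * qpow (u + 1) := by
      simp only [← qpow_add]; congr 1; simp only [exp8]; push_cast; ring
    have h3 : qpow (1 - b) * (qpow 1 * qpow (exp8 a (b - 1) c d r (u + 1, v, w))) =
        qpow (exp8 a b c d r (u, v, w)) * qpow (u + w + 2) := by
      simp only [← qpow_add]; congr 1; simp only [exp8]; push_cast; ring
    have h4 : qpow (1 - b) * (qpow 1 * qpow (exp8 a b c d r (u + 1, v, w))) =
        qpow (exp8 a b c d r (u, v, w)) * (qpow (u + 1) * qpow (u + w + 2)) := by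
      simp only [← qpow_add]; congr 1; simp only [exp8]; push_cast; ring
    have p0 : pinv (r - (u + 1 : ℕ)) = (1 - qpow (r - u)) * pinv (r - u) :=
      pinv_eq (by push_cast; ring) (by push_cast; ring)
    have p1 : pinv u = (1 - qpow (u + 1)) * pinv (u + 1 : ℕ) := pinv_eq rfl (by push_cast; ring)
    have p2 : pinv (u + w + 1) = (1 - qpow (u + w + 2)) * pinv ((u + 1 : ℕ) + w + 1) :=
      pinv_eq (by ring) (by push_cast; ring)
    simp only [h0, p0, p1, p2]
    linear_combination ((1 - qpow (r - u)) * pinv (r - u) * pinv (v - w) *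
      (pinv (u + 1 : ℕ) * pinv w * pinv ((u + 1 : ℕ) + w + 1))) * (h1 - h2 - h3 + h4)
  · obtain rfl : u = 0 := by
      rcases u with _ | u
      · rfl
      · exact absurd ⟨(u, v, w), rfl⟩ hk
    simp [exp8]

theorem S8_rel_s₂ (a b c d : ℤ) : S8 a b c d - S8 a b (c + 1) (d - 1) =
    qz (1 - d) * (S8 a (b - 1) c (d - 2) - S8 a (b - 1) c (d - 1) - q * S8 a b c (d - 1) +
      q * S8 a b c d) := by
  ext1 r
  simp only [coeff_qz_mul, coeff_q_mul, map_add, map_sub]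
  refine (((hasSum8 a b c d r).sub (hasSum8 a b (c + 1) (d - 1) r)).shift
    (fun x => (x.1, x.2.1, x.2.2 + 1))
    (fun x y h => ?_) (fun ⟨u, v, w⟩ => ?_) fun ⟨u, v, w⟩ hk => ?_).unique
    (((((hasSum8 _ _ _ _ r).sub (hasSum8 _ _ _ _ r)).sub ((hasSum8 _ _ _ _ r).mul_left _)).add
    ((hasSum8 _ _ _ _ r).mul_left _)).mul_left _)
  · simp only [Prod.mk.injEq, add_left_inj] at h
    exact Prod.ext h.1 (Prod.ext h.2.1 h.2.2)
  · have h0 : qpow (exp8 a b (c + 1) (d - 1) r (u, v, w)) =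
        qpow (exp8 a b c d r (u, v, w)) * qpow (v - w) := by
      simp only [← qpow_add]; congr 1; simp only [exp8]; ring
    have h1 : qpow (1 - d) * qpow (exp8 a (b - 1) c (d - 2) r (u, v, w + 1)) =
        qpow (exp8 a b c d r (u, v, w)) := by
      simp only [← qpow_add]; congr 1; simp only [exp8]; push_cast; ring
    have h2 : qpow (1 - d) * qpow (exp8 a (b - 1) c (d - 1) r (u, v, w + 1)) =
        qpow (exp8 a b c d r (u, v, w)) * qpow (w + 1) := by
      simp only [← qpow_add]; congr 1; simp only [exp8]; push_cast; ring
    have h3 : qpow (1 - d) * (qpow 1 * qpow (exp8 a b c (d - 1) r (u, v, w + 1))) =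
        qpow (exp8 a b c d r (u, v, w)) * qpow (u + w + 2) := by
      simp only [← qpow_add]; congr 1; simp only [exp8]; push_cast; ring
    have h4 : qpow (1 - d) * (qpow 1 * qpow (exp8 a b c d r (u, v, w + 1))) =
        qpow (exp8 a b c d r (u, v, w)) * (qpow (w + 1) * qpow (u + w + 2)) := by
      simp only [← qpow_add]; congr 1; simp only [exp8]; push_cast; ring
    have p0 : pinv (v - (w + 1 : ℕ)) = (1 - qpow (v - w)) * pinv (v - w) :=
      pinv_eq (by push_cast; ring) (by push_cast; ring)
    have p1 : pinv w = (1 - qpow (w + 1)) * pinv (w + 1 : ℕ) := pinv_eq rfl (by push_cast; ring)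
    have p2 : pinv (u + w + 1) = (1 - qpow (u + w + 2)) * pinv (u + (w + 1 : ℕ) + 1) :=
      pinv_eq (by ring) (by push_cast; ring)
    simp only [h0, p0, p1, p2]
    linear_combination (pinv (r - u) * ((1 - qpow (v - w)) * pinv (v - w)) *
      (pinv u * pinv (w + 1 : ℕ) * pinv (u + (w + 1 : ℕ) + 1))) * (h1 - h2 - h3 + h4)
  · obtain rfl : w = 0 := by
      rcases w with _ | w
      · rfl
      · exact absurd ⟨(u, v, w), rfl⟩ hk
    simp [exp8]

/-! ### Functional equations of the sums -/

theorem q_ne_zero : q ≠ 0 := by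
  intro h
  have := congrArg (PowerSeries.coeff 0) h
  simp [q] at this

/-- The subscript here and below names the profile whose equation is verified, after the candidate
sums are inserted and `σ` is carried out. The proof is a combination of the index-shift relations in
which all auxiliary sums cancel. -/
theorem S5_funeq₁₁₀ :
    S5 0 1 - S5 1 1 - q * z * S5 2 1 = 0 := by
  have h0 : q ^ 1 * (z * S5 2 1) =
      q ^ 0 * (S5 0 0 - S5 1 0 - q * S5 1 1 + q * S5 2 1) :=
    q_pow_mul_of_eq (z_mul_S5 2 1) 1 0 (by norm_num)
  have h1 : q ^ 1 * (S5 1 2) =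
      q ^ 0 * (S5 0 0 - S5 0 1 - q * S5 1 1 + q * S5 1 2) :=
    q_pow_mul_of_eq (S5_rel 1 2) 1 0 (by norm_num)
  have h2 : q ^ 1 * (S5 2 2) =
      q ^ 0 * (S5 1 0 - S5 1 1 - q * S5 2 1 + q * S5 2 2) :=
    q_pow_mul_of_eq (S5_rel 2 2) 1 0 (by norm_num)
  linear_combination -h0 + h1 - h2

/-- Reconciles the two expressions for the rotated profiles `(1,1,0)` and `(1,0,1)`. -/
theorem S5_eq₁₀₁ :
    S5 0 1 - S5 1 0 + q * S5 2 1 - q * z * S5 2 1 = 0 := by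
  have h0 : q ^ 1 * (z * S5 2 1) =
      q ^ 0 * (S5 0 0 - S5 1 0 - q * S5 1 1 + q * S5 2 1) :=
    q_pow_mul_of_eq (z_mul_S5 2 1) 1 0 (by norm_num)
  have h1 : q ^ 1 * (S5 1 2) =
      q ^ 0 * (S5 0 0 - S5 0 1 - q * S5 1 1 + q * S5 1 2) :=
    q_pow_mul_of_eq (S5_rel 1 2) 1 0 (by norm_num)
  linear_combination -h0 + h1

theorem S7_funeq₂₁₁ :
    S7 0 0 - q * S7 1 1 - S7 1 0 + q * S7 2 1 - S7 0 1 + S7 2 0 - q * S7 3 1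
      + q ^ 2 * z * S7 3 1 - q * z * S7 1 1 = 0 := by
  have h0 : q ^ 2 * (z * S7 3 1) =
      q ^ 0 * (S7 1 2 - S7 2 2 - q * S7 2 3 + q * S7 3 3) :=
    q_pow_mul_of_eq (z_mul_S7 3 1) 2 0 (by norm_num)
  have h1 : q ^ 0 * (z * S7 1 1) =
      q ^ 0 * (S7 (-1) 2 - S7 0 2 - q * S7 0 3 + q * S7 1 3) :=
    q_pow_mul_of_eq (z_mul_S7 1 1) 0 0 (by norm_num)
  have h2 : q ^ 1 * (S7 0 2) =
      q ^ 0 * (S7 1 0 - S7 1 1 - q * S7 2 1 + q * S7 2 2) :=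
    q_pow_mul_of_eq (S7_rel 0 2) 1 0 (by norm_num)
  have h3 : q ^ 2 * (S7 0 3) =
      q ^ 0 * (S7 1 1 - S7 1 2 - q * S7 2 2 + q * S7 2 3) :=
    q_pow_mul_of_eq (S7_rel 0 3) 2 0 (by norm_num)
  have h4 : q ^ 2 * (S7 1 3) =
      q ^ 0 * (S7 2 1 - S7 2 2 - q * S7 3 2 + q * S7 3 3) :=
    q_pow_mul_of_eq (S7_rel 1 3) 2 0 (by norm_num)
  have h5 : q ^ 1 * (S7 (-1) 2) =
      q ^ 0 * (S7 0 0 - S7 0 1 - q * S7 1 1 + q * S7 1 2) :=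
    q_pow_mul_of_eq (S7_rel (-1) 2) 1 0 (by norm_num)
  have h6 : q ^ 1 * (S7 1 2) =
      q ^ 0 * (S7 2 0 - S7 2 1 - q * S7 3 1 + q * S7 3 2) :=
    q_pow_mul_of_eq (S7_rel 1 2) 1 0 (by norm_num)
  linear_combination h0 - q * h1 + h2 + h3 - h4 - h5 - h6

theorem S7_funeq₂₂₀ :
    S7 (-1) 1 - z * S7 1 0 - S7 1 0 + q * S7 2 1 - q * z * S7 2 0 = 0 := by
  have h0 : q ^ 0 * (z * S7 1 0) =
      q ^ 0 * (S7 (-1) 1 - S7 0 1 - q * S7 0 2 + q * S7 1 2) :=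
    q_pow_mul_of_eq (z_mul_S7 1 0) 0 0 (by norm_num)
  have h1 : q ^ 1 * (z * S7 2 0) =
      q ^ 0 * (S7 0 1 - S7 1 1 - q * S7 1 2 + q * S7 2 2) :=
    q_pow_mul_of_eq (z_mul_S7 2 0) 1 0 (by norm_num)
  have h2 : q ^ 1 * (S7 0 2) =
      q ^ 0 * (S7 1 0 - S7 1 1 - q * S7 2 1 + q * S7 2 2) :=
    q_pow_mul_of_eq (S7_rel 0 2) 1 0 (by norm_num)
  linear_combination -h0 - h1 + h2

/-- Reconciles the two expressions for the rotated profiles `(2,2,1)` and `(2,1,2)`. -/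
theorem S8_eq₂₁₂ :
    S8 0 0 0 1 - q * S8 0 1 1 1 - S8 0 1 0 0 + q * S8 1 1 0 1 = 0 := by
  have h0 : q ^ 1 * (S8 0 1 0 2 - S8 0 1 1 1) =
      q ^ 0 * (S8 0 0 0 0 - S8 0 0 0 1 - q * S8 0 1 0 1 + q * S8 0 1 0 2) :=
    q_pow_mul_of_eq (S8_rel_s₂ 0 1 0 2) 1 0 (by norm_num)
  have h1 : q ^ 1 * (S8 0 2 0 1 - S8 1 1 0 1) =
      q ^ 0 * (S8 0 0 0 0 - S8 0 1 0 0 - q * S8 0 1 0 1 + q * S8 0 2 0 1) :=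
    q_pow_mul_of_eq (S8_rel_r₂ 0 2 0 1) 1 0 (by norm_num)
  linear_combination h0 - h1

theorem S8_funeq₄₁₀ :
    S8 0 1 1 1 - S8 1 0 1 1 - q * z * S8 2 1 0 1 = 0 := by
  have h0 : q ^ 1 * (z * S8 2 1 0 1) =
      q ^ 0 * (S8 0 1 1 1 - S8 1 0 1 1) :=
    q_pow_mul_of_eq (z_mul_S8 2 1 0 1) 1 0 (by norm_num)
  linear_combination -h0

theorem S8_funeq₃₂₀ :
    S8 0 0 1 1 - S8 1 1 0 1 + q * S8 2 1 1 1 - q * z * S8 2 1 0 0 = 0 := by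
  have h0 : q ^ 1 * (z * S8 2 1 0 0) =
      q ^ 0 * (S8 0 1 1 0 - S8 1 0 1 0) :=
    q_pow_mul_of_eq (z_mul_S8 2 1 0 0) 1 0 (by norm_num)
  have h1 : q ^ 1 * (S8 0 1 2 1) =
      q ^ 0 * (S8 1 1 0 1 - S8 1 1 1 0) :=
    q_pow_mul_of_eq (S8_rel_s₁ 0 1 2 1) 1 0 (by norm_num)
  have h2 : q ^ 1 * (S8 1 2 1 1 - S8 2 1 1 1) =
      q ^ 0 * (S8 1 0 1 0 - S8 1 1 1 0 - q * S8 1 1 1 1 + q * S8 1 2 1 1) :=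
    q_pow_mul_of_eq (S8_rel_r₂ 1 2 1 1) 1 0 (by norm_num)
  have h3 : q ^ 1 * (S8 0 1 1 2 - S8 0 1 2 1) =
      q ^ 0 * (S8 0 0 1 0 - S8 0 0 1 1 - q * S8 0 1 1 1 + q * S8 0 1 1 2) :=
    q_pow_mul_of_eq (S8_rel_s₂ 0 1 1 2) 1 0 (by norm_num)
  have h4 : q ^ 1 * (S8 0 2 1 1 - S8 1 1 1 1) =
      q ^ 0 * (S8 0 0 1 0 - S8 0 1 1 0 - q * S8 0 1 1 1 + q * S8 0 2 1 1) :=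
    q_pow_mul_of_eq (S8_rel_r₂ 0 2 1 1) 1 0 (by norm_num)
  linear_combination -h0 + h1 - h2 + h3 - h4

theorem S8_funeq₃₁₁ :
    S8 0 1 0 1 - S8 1 1 1 1 - q * S8 1 1 1 1 - S8 1 1 0 0 + q * S8 2 1 0 1
      + q ^ 2 * z * S8 3 1 0 1 - q * z * S8 2 1 0 0 + S8 2 0 1 1 - q * z * S8 2 0 1 1
      - q ^ 3 * z ^ 2 * S8 3 1 0 1 = 0 := by
  have h0 : q ^ 2 * (z * S8 3 1 0 1) =
      q ^ 0 * (S8 1 1 1 1 - S8 2 0 1 1) :=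
    q_pow_mul_of_eq (z_mul_S8 3 1 0 1) 2 0 (by norm_num)
  have h1 : q ^ 1 * (z * S8 2 1 0 0) =
      q ^ 0 * (S8 0 1 1 0 - S8 1 0 1 0) :=
    q_pow_mul_of_eq (z_mul_S8 2 1 0 0) 1 0 (by norm_num)
  have h2 : q ^ 0 * (z * S8 1 1 1 1) =
      q ^ 0 * (S8 (-1) 1 2 1 - S8 0 0 2 1) :=
    q_pow_mul_of_eq (z_mul_S8 1 1 1 1) 0 0 (by norm_num)
  have h3 : q ^ 1 * (S8 1 2 0 1 - S8 2 1 0 1) =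
      q ^ 0 * (S8 1 0 0 0 - S8 1 1 0 0 - q * S8 1 1 0 1 + q * S8 1 2 0 1) :=
    q_pow_mul_of_eq (S8_rel_r₂ 1 2 0 1) 1 0 (by norm_num)
  have h4 : q ^ 1 * (S8 0 0 2 1) =
      q ^ 0 * (S8 1 0 0 1 - S8 1 0 1 0) :=
    q_pow_mul_of_eq (S8_rel_s₁ 0 0 2 1) 1 0 (by norm_num)
  have h5 : q ^ 1 * (S8 (-1) 1 2 1) =
      q ^ 0 * (S8 0 1 0 1 - S8 0 1 1 0) :=
    q_pow_mul_of_eq (S8_rel_s₁ (-1) 1 2 1) 1 0 (by norm_num)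
  have h6 : q ^ 1 * (S8 1 1 0 2 - S8 1 1 1 1) =
      q ^ 0 * (S8 1 0 0 0 - S8 1 0 0 1 - q * S8 1 1 0 1 + q * S8 1 1 0 2) :=
    q_pow_mul_of_eq (S8_rel_s₂ 1 1 0 2) 1 0 (by norm_num)
  linear_combination (1 - q * z) * h0 - h1 - q * h2 - h3 + h4 - h5 + h6

theorem S8_funeq₂₁₂ :
    S8 0 1 0 0 - S8 1 1 0 1 - q * S8 1 1 0 1 + q * S8 2 1 1 1 - S8 1 1 0 0 + S8 2 1 0 1
      + q * S8 2 1 0 1 - S8 1 0 1 1 + S8 2 1 0 0 - q * S8 3 1 0 1 - q * z * S8 2 1 0 0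
      + q ^ 2 * z * S8 3 1 0 1 + q ^ 2 * z * S8 3 1 0 0 - q * S8 3 1 1 1 - q * z * S8 2 1 0 1
      + q ^ 2 * z * S8 3 1 1 1 - q ^ 3 * z ^ 2 * S8 3 1 0 0 = 0 := by
  have h0 : q ^ 1 * (z * S8 2 1 0 0) =
      q ^ 0 * (S8 0 1 1 0 - S8 1 0 1 0) :=
    q_pow_mul_of_eq (z_mul_S8 2 1 0 0) 1 0 (by norm_num)
  have h1 : q ^ 2 * (z * S8 3 1 0 1) =
      q ^ 0 * (S8 1 1 1 1 - S8 2 0 1 1) :=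
    q_pow_mul_of_eq (z_mul_S8 3 1 0 1) 2 0 (by norm_num)
  have h2 : q ^ 2 * (z * S8 3 1 0 0) =
      q ^ 0 * (S8 1 1 1 0 - S8 2 0 1 0) :=
    q_pow_mul_of_eq (z_mul_S8 3 1 0 0) 2 0 (by norm_num)
  have h3 : q ^ 1 * (z * S8 2 1 0 1) =
      q ^ 0 * (S8 0 1 1 1 - S8 1 0 1 1) :=
    q_pow_mul_of_eq (z_mul_S8 2 1 0 1) 1 0 (by norm_num)
  have h4 : q ^ 2 * (z * S8 3 1 1 1) =
      q ^ 0 * (S8 1 1 2 1 - S8 2 0 2 1) :=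
    q_pow_mul_of_eq (z_mul_S8 3 1 1 1) 2 0 (by norm_num)
  have h5 : q ^ 0 * (z * S8 1 1 1 0) =
      q ^ 0 * (S8 (-1) 1 2 0 - S8 0 0 2 0) :=
    q_pow_mul_of_eq (z_mul_S8 1 1 1 0) 0 0 (by norm_num)
  have h6 : q ^ 1 * (z * S8 2 0 1 0) =
      q ^ 0 * (S8 0 0 2 0 - S8 1 (-1) 2 0) :=
    q_pow_mul_of_eq (z_mul_S8 2 0 1 0) 1 0 (by norm_num)
  have h7 : q ^ 1 * (S8 (-1) 1 2 0) =
      q ^ 0 * (S8 0 1 0 0 - S8 0 1 1 (-1)) :=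
    q_pow_mul_of_eq (S8_rel_s₁ (-1) 1 2 0) 1 0 (by norm_num)
  have h8 : q ^ 1 * (S8 1 2 0 1 - S8 2 1 0 1) =
      q ^ 0 * (S8 1 0 0 0 - S8 1 1 0 0 - q * S8 1 1 0 1 + q * S8 1 2 0 1) :=
    q_pow_mul_of_eq (S8_rel_r₂ 1 2 0 1) 1 0 (by norm_num)
  have h9 : q ^ 1 * (S8 0 2 1 0 - S8 1 1 1 0) =
      q ^ 0 * (S8 0 0 1 (-1) - S8 0 1 1 (-1) - q * S8 0 1 1 0 + q * S8 0 2 1 0) :=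
    q_pow_mul_of_eq (S8_rel_r₂ 0 2 1 0) 1 0 (by norm_num)
  have h10 : q ^ 1 * (S8 1 0 2 1) =
      q ^ 0 * (S8 2 0 0 1 - S8 2 0 1 0) :=
    q_pow_mul_of_eq (S8_rel_s₁ 1 0 2 1) 1 0 (by norm_num)
  have h11 : q ^ 1 * (S8 0 0 2 0) =
      q ^ 0 * (S8 1 0 0 0 - S8 1 0 1 (-1)) :=
    q_pow_mul_of_eq (S8_rel_s₁ 0 0 2 0) 1 0 (by norm_num)
  have h12 : q ^ 1 * (S8 0 2 1 1 - S8 1 1 1 1) =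
      q ^ 0 * (S8 0 0 1 0 - S8 0 1 1 0 - q * S8 0 1 1 1 + q * S8 0 2 1 1) :=
    q_pow_mul_of_eq (S8_rel_r₂ 0 2 1 1) 1 0 (by norm_num)
  have h13 : q ^ 0 * (S8 0 1 1 1 - S8 0 1 2 0) =
      q ^ 0 * (S8 0 0 1 (-1) - S8 0 0 1 0 - q * S8 0 1 1 0 + q * S8 0 1 1 1) :=
    q_pow_mul_of_eq (S8_rel_s₂ 0 1 1 1) 0 0 (by norm_num)
  have h14 : q ^ 1 * (S8 2 2 0 1 - S8 3 1 0 1) =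
      q ^ 0 * (S8 2 0 0 0 - S8 2 1 0 0 - q * S8 2 1 0 1 + q * S8 2 2 0 1) :=
    q_pow_mul_of_eq (S8_rel_r₂ 2 2 0 1) 1 0 (by norm_num)
  have h15 : q ^ 1 * (S8 2 1 0 2 - S8 2 1 1 1) =
      q ^ 0 * (S8 2 0 0 0 - S8 2 0 0 1 - q * S8 2 1 0 1 + q * S8 2 1 0 2) :=
    q_pow_mul_of_eq (S8_rel_s₂ 2 1 0 2) 1 0 (by norm_num)
  have h16 : q ^ 1 * (S8 2 2 1 1 - S8 3 1 1 1) =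
      q ^ 0 * (S8 2 0 1 0 - S8 2 1 1 0 - q * S8 2 1 1 1 + q * S8 2 2 1 1) :=
    q_pow_mul_of_eq (S8_rel_r₂ 2 2 1 1) 1 0 (by norm_num)
  have h17 : q ^ 1 * (S8 1 2 1 0 - S8 2 1 1 0) =
      q ^ 0 * (S8 1 0 1 (-1) - S8 1 1 1 (-1) - q * S8 1 1 1 0 + q * S8 1 2 1 0) :=
    q_pow_mul_of_eq (S8_rel_r₂ 1 2 1 0) 1 0 (by norm_num)
  have h18 : q ^ 1 * (S8 1 2 2 1 - S8 2 1 2 1) =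
      q ^ 0 * (S8 1 0 2 0 - S8 1 1 2 0 - q * S8 1 1 2 1 + q * S8 1 2 2 1) :=
    q_pow_mul_of_eq (S8_rel_r₂ 1 2 2 1) 1 0 (by norm_num)
  have h19 : q ^ 1 * (S8 2 1 1 2 - S8 2 1 2 1) =
      q ^ 0 * (S8 2 0 1 0 - S8 2 0 1 1 - q * S8 2 1 1 1 + q * S8 2 1 1 2) :=
    q_pow_mul_of_eq (S8_rel_s₂ 2 1 1 2) 1 0 (by norm_num)
  have h20 : q ^ 0 * (S8 1 1 1 1 - S8 1 1 2 0) =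
      q ^ 0 * (S8 1 0 1 (-1) - S8 1 0 1 0 - q * S8 1 1 1 0 + q * S8 1 1 1 1) :=
    q_pow_mul_of_eq (S8_rel_s₂ 1 1 1 1) 0 0 (by norm_num)
  have h21 : q ^ 0 * (S8 1 1 2 1 - S8 2 0 2 1) =
      q ^ 0 * (S8 1 (-1) 2 0 - S8 1 0 2 0 - q * S8 1 0 2 1 + q * S8 1 1 2 1) :=
    q_pow_mul_of_eq (S8_rel_r₂ 1 1 2 1) 0 0 (by norm_num)
  have h22 : q ^ 1 * (S8 0 1 2 0) =
      q ^ 0 * (S8 1 1 0 0 - S8 1 1 1 (-1)) :=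
    q_pow_mul_of_eq (S8_rel_s₁ 0 1 2 0) 1 0 (by norm_num)
  -- The combination below yields `q` times the claim, and the ring has no zero divisors.
  refine (mul_eq_zero.mp ?_).resolve_left q_ne_zero
  linear_combination -q * h0 + q * h1 + (q - q ^ 2 * z) * h2 - q * h3 + q * h4 - q ^ 2 * h5 + q * h6
    - q * h7 + (- 1 - q) * h8 + q * h9 - q * h10 + (1 + q) * h11 - q * h12 - q * h13
    + q * h14 - q * h15 + q * h16 + h17 + q * h18 - q * h19 + q * h20 + q * h21
    - h22

/-! ### Constant terms in `z` of the sums -/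

theorem pinv_natCast_ne_zero (n : ℕ) : pinv n ≠ 0 := by
  intro h
  have := pinv_natCast n ▸ h
  rw [toLaurent, map_eq_zero_iff _ HahnSeries.ofPowerSeries_injective] at this
  have h1 := qPoch_mul_inv n
  rw [this, mul_zero] at h1
  exact zero_ne_one h1

theorem one_sub_qpow_ne_zero (n : ℕ) : 1 - qpow (n + 1) ≠ 0 := by
  intro h
  have := pinv_sub_one (n + 1)
  rw [h, zero_mul, add_sub_cancel_right] at this
  exact pinv_natCast_ne_zero n this

/-- With `a_r` for the coefficients, `S5_funeq₁₁₀` reads `(1 - q^(r+1)) a_(r+1) = q^(2r+1) a_r`,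
which is solved by iteration. -/
theorem coeff_S5_zero_one (r : ℕ) : PowerSeries.coeff r (S5 0 1) =
    qpow (r ^ 2) * (pinv r * PowerSeries.coeff 0 (S5 0 1)) := by
  induction r with
  | zero => simp [qpow_zero, pinv_zero]
  | succ r ih =>
    have h := congrArg (PowerSeries.coeff (r + 1)) S5_funeq₁₁₀
    have e1 : S5 1 1 = σ (S5 0 1) := (σ_S5 0 1).symm
    have e2 : S5 2 1 = σ (σ (S5 0 1)) := by rw [σ_S5, σ_S5]; rfl
    rw [e1, e2, map_sub, map_sub, coeff_σ, mul_assoc, coeff_q_mul, coeff_z_mul_succ, coeff_σ, coeff_σ, ih, map_zero,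
      pinv_eq (n := r) (m := r + 1) (k := (r + 1 : ℕ)) rfl (by push_cast; ring)] at h
    apply mul_left_cancel₀ (one_sub_qpow_ne_zero r)
    have e : qpow ((r + 1 : ℕ) ^ 2) = qpow 1 * (qpow r * (qpow r * qpow (r ^ 2))) := by
      simp only [← qpow_add]; congr 1; push_cast; ring
    rw [e]
    push_cast at h ⊢
    linear_combination h

theorem coeff_qPoch_of_le {k N : ℕ} (h : k ≤ N) :
    PowerSeries.coeff k (qPoch N) = PowerSeries.coeff k (qPoch k) := by
  induction N, h using Nat.le_induction with
  | base => rfl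
  | succ N hN ih =>
    rw [qPoch, Finset.prod_range_succ, ← qPoch, mul_sub, mul_one, map_sub, ih,
      PowerSeries.coeff_mul_X_pow', if_neg (by omega), sub_zero]

theorem coeff_inv_congr {f g : ℚ⟦X⟧} {m : ℕ} (hf : PowerSeries.constantCoeff f ≠ 0)
    (hg : PowerSeries.constantCoeff g ≠ 0)
    (h : ∀ k ≤ m, PowerSeries.coeff k f = PowerSeries.coeff k g) :
    PowerSeries.coeff m f⁻¹ = PowerSeries.coeff m g⁻¹ := by
  have hd : PowerSeries.X ^ (m + 1) ∣ g - f := by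
    rw [PowerSeries.X_pow_dvd_iff]
    intro k hk
    rw [map_sub, h k (by omega), sub_self]
  have e : f⁻¹ - g⁻¹ = (g - f) * (f⁻¹ * g⁻¹) := by
    have h1 := PowerSeries.mul_inv_cancel f hf
    have h2 := PowerSeries.mul_inv_cancel g hg
    linear_combination (-f⁻¹) * h2 + g⁻¹ * h1
  have := PowerSeries.X_pow_dvd_iff.mp (e ▸ hd.mul_right _) m (by omega)
  rwa [map_sub, sub_eq_zero] at this

/-- `(q)_N` and `(q)_∞` agree up to order `m`, and inversion respects congruence modulo `X^(m+1)`.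
-/
theorem coeff_qPochInf_inv {m N : ℕ} (h : m ≤ N) :
    PowerSeries.coeff m (qPoch N)⁻¹ = PowerSeries.coeff m qPochInf⁻¹ := by
  refine coeff_inv_congr (by simp [constantCoeff_qPoch]) ?_ fun k hk => ?_
  · rw [← PowerSeries.coeff_zero_eq_constantCoeff_apply]
    simp [qPochInf, qPoch]
  · rw [coeff_qPoch_of_le (by omega), qPochInf, PowerSeries.coeff_mk]

theorem coeff_toLaurent (P : ℚ⟦X⟧) (m : ℤ) :
    (toLaurent P).coeff m = if m < 0 then 0 else PowerSeries.coeff m.natAbs P :=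
  PowerSeries.coeff_coe P m

/-- By `coeff_S5_zero_one`, the constant term equals the sum over `s` of `q^(s^2+rs+s) / ((q)_s
(q)_(r+s+1))` for every `r`. As `r` grows only `s = 0` survives, with value `1 / (q)_(r+1)`, which
tends to `1 / (q)_∞`. -/
theorem coeff_zero_S5_one (A : ℤ) :
    PowerSeries.coeff 0 (S5 A 1) = toLaurent qPochInf⁻¹ := by
  have hA : PowerSeries.coeff 0 (S5 A 1) = PowerSeries.coeff 0 (S5 0 1) :=
    (hasSum5 A 1 0).unique ((hasSum5 0 1 0).congr fun s => by simp [exp5])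
  rw [hA]
  ext m
  -- To read the coefficient of `q^m` it is enough to take `r = m.toNat`: the terms with `s ≥ 1`
  -- then have order greater than `m`.
  have h := (hasSum5 0 1 m.toNat).mul_left (qpow (-(m.toNat : ℤ) ^ 2) * (pinv m.toNat)⁻¹)
  rw [coeff_S5_zero_one] at h
  have e : qpow (-(m.toNat : ℤ) ^ 2) * (pinv m.toNat)⁻¹ * (qpow ((m.toNat : ℤ) ^ 2) *
      (pinv m.toNat * PowerSeries.coeff 0 (S5 0 1))) = PowerSeries.coeff 0 (S5 0 1) := by
    have h1 : qpow (-(m.toNat : ℤ) ^ 2) * qpow ((m.toNat : ℤ) ^ 2) = 1 := by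
      rw [← qpow_add, neg_add_cancel, qpow_zero]
    have h2 := inv_mul_cancel₀ (pinv_natCast_ne_zero m.toNat)
    linear_combination (PowerSeries.coeff 0 (S5 0 1)) * (pinv m.toNat)⁻¹ * pinv m.toNat * h1 +
      (PowerSeries.coeff 0 (S5 0 1)) * h2
  rw [e] at h
  rw [h.coeff m, finsum_eq_single _ 0]
  · have e2 : qpow (-(m.toNat : ℤ) ^ 2) * (pinv m.toNat)⁻¹ * (qpow (exp5 0 1 m.toNat 0) *
        (pinv m.toNat * pinv (0 : ℕ) * pinv (m.toNat + (0 : ℕ) + 1))) =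
        toLaurent (qPoch (m.toNat + 1))⁻¹ := by
      have h1 : qpow (-(m.toNat : ℤ) ^ 2) * qpow (exp5 0 1 m.toNat 0) = 1 := by
        rw [← qpow_add, ← qpow_zero]; congr 1; simp [exp5]
      have h2 := inv_mul_cancel₀ (pinv_natCast_ne_zero m.toNat)
      rw [← pinv_natCast, Nat.cast_zero, pinv_zero, Nat.cast_succ, add_zero]
      linear_combination (pinv (m.toNat + 1)) * (pinv m.toNat)⁻¹ * pinv m.toNat * h1 +
        (pinv (m.toNat + 1)) * h2
    rw [e2, coeff_toLaurent, coeff_toLaurent]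
    split_ifs with hm
    · rfl
    · exact coeff_qPochInf_inv (by omega)
  · intro s hs
    by_contra hne
    have e3 : qpow (-(m.toNat : ℤ) ^ 2) * (pinv m.toNat)⁻¹ * (qpow (exp5 0 1 m.toNat s) *
        (pinv m.toNat * pinv s * pinv (m.toNat + s + 1))) =
        HahnSeries.single ((s : ℤ) ^ 2 + m.toNat * s + s) (1 : ℚ) *
        toLaurent (qPochInv s * qPochInv (m.toNat + s + 1)) := by
      have h1 : qpow (-(m.toNat : ℤ) ^ 2) * qpow (exp5 0 1 m.toNat s) =
          qpow ((s : ℤ) ^ 2 + m.toNat * s + s) := by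
        rw [← qpow_add]; congr 1; simp only [exp5]; ring
      have h2 := inv_mul_cancel₀ (pinv_natCast_ne_zero m.toNat)
      rw [map_mul]
      change _ = qpow _ * (pinv s * pinv (m.toNat + s + 1))
      rw [← h1]
      linear_combination (qpow (-(m.toNat : ℤ) ^ 2) * qpow (exp5 0 1 m.toNat s)) *
        (pinv s * pinv (m.toNat + s + 1)) * h2
    rw [e3] at hne
    have := le_of_coeff_ne_zero hne
    have hs1 : (1 : ℤ) ≤ s := by omega
    have : m ≤ m.toNat := Int.self_le_toNat m
    nlinarith [Int.natCast_nonneg m.toNat]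

theorem coeff_zero_S7_one (A : ℤ) :
    PowerSeries.coeff 0 (S7 A 1) = toLaurent qPochInf⁻¹ := by
  rw [← coeff_zero_S5_one 0]
  exact (hasSum7 A 1 0).unique ((hasSum5 0 1 0).congr fun s => by simp [exp5, exp7])

theorem coeff_zero_S7_congr (A A' B : ℤ) :
    PowerSeries.coeff 0 (S7 A B) = PowerSeries.coeff 0 (S7 A' B) :=
  (hasSum7 A B 0).unique ((hasSum7 A' B 0).congr fun s => by simp [exp7])

theorem coeff_zero_S8_congr (A A' B B' C D : ℤ) :
    PowerSeries.coeff 0 (S8 A B C D) = PowerSeries.coeff 0 (S8 A' B' C D) := by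
  refine (hasSum8 A B C D 0).unique ((hasSum8 A' B' C D 0).congr fun ⟨u, v, w⟩ => ?_)
  rcases u with _ | u
  · simp [exp8]
  · rw [pinv_of_neg (n := ((0 : ℕ) : ℤ) - (u + 1 : ℕ)) (by push_cast; omega)]
    simp

/-- In the constant term of `S7_rel 0 2` the unknown value at second parameter 2 occurs on both
sides and cancels, because the first parameter does not matter there. -/
theorem coeff_zero_S7_zero (A : ℤ) :
    PowerSeries.coeff 0 (S7 A 0) = (1 + qpow 1) * toLaurent qPochInf⁻¹ := by
  have h : q ^ 1 * (S7 0 2) = q ^ 0 * (S7 1 0 - S7 1 1 - q * S7 2 1 + q * S7 2 2) :=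
    q_pow_mul_of_eq (S7_rel 0 2) 1 0 (by norm_num)
  have h := congrArg (PowerSeries.coeff 0) h
  rw [pow_one, pow_zero, one_mul] at h
  simp only [map_add, map_sub, coeff_q_mul, coeff_zero_S7_one] at h
  rw [coeff_zero_S7_congr 0 2 2, coeff_zero_S7_congr 1 A 0] at h
  linear_combination -h

/-- A form of the `q`-Chu–Vandermonde sum. -/
theorem sum_qpow_pinv (N : ℕ) : ∀ n : ℕ, ∑ k ∈ Finset.range (N + 1),
    qpow (k ^ 2 + n * k) * (pinv (N - k) * pinv k * pinv (k + n)) = pinv N * pinv (N + n) := by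
  induction N with
  | zero => intro n; simp [qpow_zero, pinv_zero]
  | succ N ih =>
    intro n
    apply mul_left_cancel₀ (one_sub_qpow_ne_zero N)
    -- Splitting `1 - q^(N+1) = (1 - q^(N+1-k)) + q^(N+1-k) (1 - q^k)` lowers either `N + 1 - k` or
    -- `k`. After `k ↦ k + 1` the second part is the sum for `(N, n + 1)`, so the induction is on
    -- `N` for all `n` at once.
    have key : ∀ k : ℕ, (1 - qpow (N + 1)) * (qpow (k ^ 2 + n * k) *
        (pinv ((N + 1 : ℕ) - k) * pinv k * pinv (k + n))) =
        qpow (k ^ 2 + n * k) * (pinv (N - k) * pinv k * pinv (k + n)) +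
        qpow (N + 1 - k) * (qpow (k ^ 2 + n * k) *
          (pinv ((N + 1 : ℕ) - k) * pinv (k - 1) * pinv (k + n))) := by
      intro k
      have p1 : pinv (N - k) = (1 - qpow (N + 1 - k)) * pinv ((N + 1 : ℕ) - k) :=
        pinv_eq (by ring) (by push_cast; ring)
      have e : qpow (N + 1) = qpow (N + 1 - k) * qpow k := by rw [← qpow_add]; congr 1; ring
      rw [p1, pinv_sub_one, e]
      ring
    rw [Finset.mul_sum, Finset.sum_congr rfl fun k _ => key k, Finset.sum_add_distrib,
      Finset.sum_range_succ, ih n, Finset.sum_range_succ']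
    have h0 : pinv ((N : ℤ) - (N + 1 : ℕ)) = 0 := pinv_of_neg (by push_cast; omega)
    have h1 : pinv (((0 : ℕ) : ℤ) - 1) = 0 := pinv_of_neg (by norm_num)
    rw [h0, h1]
    have h2 : ∀ k : ℕ, qpow (N + 1 - (k + 1 : ℕ)) * (qpow ((k + 1 : ℕ) ^ 2 + n * (k + 1 : ℕ)) *
          (pinv ((N + 1 : ℕ) - (k + 1 : ℕ)) * pinv ((k + 1 : ℕ) - 1) * pinv ((k + 1 : ℕ) + n))) =
        qpow (N + n + 1) * (qpow (k ^ 2 + (n + 1 : ℕ) * k) *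
          (pinv (N - k) * pinv k * pinv (k + (n + 1 : ℕ)))) := by
      intro k
      have e : qpow (N + 1 - (k + 1 : ℕ)) * qpow ((k + 1 : ℕ) ^ 2 + n * (k + 1 : ℕ)) =
          qpow (N + n + 1) * qpow (k ^ 2 + (n + 1 : ℕ) * k) := by
        simp only [← qpow_add]; congr 1; push_cast; ring
      rw [show ((N + 1 : ℕ) : ℤ) - (k + 1 : ℕ) = N - k by push_cast; ring,
        show ((k + 1 : ℕ) : ℤ) - 1 = k by push_cast; ring,
        show ((k + 1 : ℕ) : ℤ) + n = k + (n + 1 : ℕ) by push_cast; ring]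
      linear_combination (pinv (N - k) * pinv k * pinv (k + (n + 1 : ℕ))) * e
    rw [Finset.sum_congr rfl fun k _ => h2 k, ← Finset.mul_sum, ih (n + 1),
      pinv_eq (n := N) (m := N + 1) (k := (N + 1 : ℕ)) rfl (by push_cast; ring),
      pinv_eq (n := N + n) (m := N + n + 1) (k := (N + 1 : ℕ) + n) rfl (by push_cast; ring),
      show (N : ℤ) + (n + 1 : ℕ) = (N + 1 : ℕ) + n by push_cast; ring]
    ring

/-- At `r₁ = 0` only `r₂ = 0` contributes. The sum over `s₂` is then `sum_qpow_pinv` with `n = 1`,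
which leaves the single sum over `s₁` of `coeff_zero_S7_one`. -/
theorem coeff_zero_S8_one_one (A B : ℤ) :
    PowerSeries.coeff 0 (S8 A B 1 1) = toLaurent qPochInf⁻¹ := by
  rw [← coeff_zero_S7_one 0]
  ext m
  have hS := hasSum8 A B 1 1 0
  set f : ℕ × ℕ → ℚ := fun x => (qpow (x.1 ^ 2 + x.1) * (qpow (x.2 ^ 2 + (1 : ℕ) * x.2) *
    (pinv (x.1 - x.2) * pinv x.2 * pinv (x.2 + (1 : ℕ))))).coeff m with hf
  have e : ∀ x : ℕ × ℕ × ℕ, (qpow (exp8 A B 1 1 0 x) * (pinv ((0 : ℕ) - x.1) *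
      pinv (x.2.1 - x.2.2) * (pinv x.1 * pinv x.2.2 * pinv (x.1 + x.2.2 + 1)))).coeff m =
      if x.1 = 0 then f x.2 else 0 := by
    rintro ⟨u, v, w⟩
    rcases u with _ | u
    · rw [if_pos rfl, hf]
      simp only [Nat.cast_zero, sub_zero, pinv_zero, one_mul, zero_add, Nat.cast_one]
      rw [show exp8 A B 1 1 0 (0, v, w) = (v : ℤ) ^ 2 + v + (w ^ 2 + w) by simp [exp8]; ring,
        qpow_add, mul_assoc, mul_assoc (pinv _)]
    · rw [pinv_of_neg (n := ((0 : ℕ) : ℤ) - (u + 1 : ℕ)) (by push_cast; omega)]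
      simp
  have hfin := hS.finite_support m
  have hc := hS.coeff m
  simp only [e] at hfin hc
  rw [hc, (hasSum7 0 1 0).coeff m, finsum_curry _ hfin, finsum_eq_single _ 0]
  swap
  · intro u hu
    simp [hu]
  simp only [if_true]
  have hfin2 : (Function.support f).Finite := by
    refine (hfin.image Prod.snd).subset fun x hx => ⟨(0, x), ?_, rfl⟩
    simpa using hx
  rw [finsum_curry _ hfin2]
  refine finsum_congr fun v => ?_
  -- The factor `1 / (q)_(v-w)` vanishes for `w > v`.
  rw [finsum_eq_sum_of_support_subset (s := Finset.range (v + 1))]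
  · rw [hf]
    simp only
    rw [← HahnSeries.coeff_sum, ← Finset.mul_sum, sum_qpow_pinv v 1]
    congr 2
    · simp [exp7]
    · simp [pinv_zero]
  · intro w hw
    rw [Finset.coe_range, Set.mem_Iio]
    by_contra hlt
    apply hw
    rw [hf]
    simp only
    rw [pinv_of_neg (n := (v : ℤ) - w) (by omega)]
    simp

/-- The constant terms with last parameters `(2,1)`, `(1,0)` and `(1,2)` are unknown, but they
cancel between the two relations. -/
theorem coeff_zero_S8_zero_one (A B : ℤ) :
    PowerSeries.coeff 0 (S8 A B 0 1) = (1 + qpow 1) * toLaurent qPochInf⁻¹ := by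
  have h1 : q ^ 1 * S8 0 0 2 1 = q ^ 0 * (S8 1 0 0 1 - S8 1 0 1 0) :=
    q_pow_mul_of_eq (S8_rel_s₁ 0 0 2 1) 1 0 (by norm_num)
  have h2 : q ^ 1 * (S8 0 0 1 2 - S8 0 0 2 1) =
      q ^ 0 * (S8 0 (-1) 1 0 - S8 0 (-1) 1 1 - q * S8 0 0 1 1 + q * S8 0 0 1 2) :=
    q_pow_mul_of_eq (S8_rel_s₂ 0 0 1 2) 1 0 (by norm_num)
  have h1 := congrArg (PowerSeries.coeff 0) h1
  have h2 := congrArg (PowerSeries.coeff 0) h2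
  rw [pow_one, pow_zero, one_mul] at h1 h2
  simp only [map_add, map_sub, coeff_q_mul, coeff_zero_S8_one_one] at h1 h2
  rw [coeff_zero_S8_congr 1 A 0 B, coeff_zero_S8_congr 1 0 0 0] at h1
  rw [coeff_zero_S8_congr 0 0 (-1) 0] at h2
  linear_combination -h1 - h2

theorem coeff_zero_S8_zero_zero (A B : ℤ) :
    PowerSeries.coeff 0 (S8 A B 0 0) =
      (1 + qpow 1 + qpow 1 * qpow 1) * toLaurent qPochInf⁻¹ := by
  have h1 : q ^ 1 * (S8 0 0 0 2 - S8 0 0 1 1) =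
      q ^ 0 * (S8 0 (-1) 0 0 - S8 0 (-1) 0 1 - q * S8 0 0 0 1 + q * S8 0 0 0 2) :=
    q_pow_mul_of_eq (S8_rel_s₂ 0 0 0 2) 1 0 (by norm_num)
  have h1 := congrArg (PowerSeries.coeff 0) h1
  rw [pow_one, pow_zero, one_mul] at h1
  simp only [map_add, map_sub, coeff_q_mul, coeff_zero_S8_one_one, coeff_zero_S8_zero_one] at h1
  rw [coeff_zero_S8_congr 0 A (-1) B] at h1
  linear_combination -h1

/-! ### Uniqueness of solutions of the functional equations -/

/-- The smallest set of series that contains all `σ (D j)` and is closed under addition,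
subtraction, multiplication by `z` and by `q`, and the substitution `σ`. -/
inductive ShiftSpan {ι : Type} (D : ι → ZQ) : ZQ → Prop
  | base (j : ι) : ShiftSpan D (σ (D j))
  | add {x y : ZQ} : ShiftSpan D x → ShiftSpan D y → ShiftSpan D (x + y)
  | sub {x y : ZQ} : ShiftSpan D x → ShiftSpan D y → ShiftSpan D (x - y)
  | z_mul {x : ZQ} : ShiftSpan D x → ShiftSpan D (z * x)
  | q_mul {x : ZQ} : ShiftSpan D x → ShiftSpan D (q * x)
  | shift {x : ZQ} : ShiftSpan D x → ShiftSpan D (σ x)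

theorem coeff_qpow_mul (a : ℤ) (f : LaurentSeries ℚ) (k : ℤ) :
    (qpow a * f).coeff k = f.coeff (k - a) := by
  rw [qpow, HahnSeries.coeff_single_mul, one_mul]

/-- If all `D i` start at `z^n`, each `σ` raises the order in `q` of the `z^n` coefficient by `n`.
Multiplication by `z` kills that coefficient, and the other operations do not lower its order. -/
theorem ShiftSpan.low_order {ι : Type} {D : ι → ZQ} {n : ℕ} {N : ℤ}
    (hlow : ∀ i, ∀ m < n, PowerSeries.coeff m (D i) = 0)
    (hN : ∀ i, ∀ k < N, (PowerSeries.coeff n (D i)).coeff k = 0) {x : ZQ} (hx : ShiftSpan D x) :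
    (∀ m < n, PowerSeries.coeff m x = 0) ∧
      ∀ k < N + n, (PowerSeries.coeff n x).coeff k = 0 := by
  induction hx with
  | base j =>
    refine ⟨fun m hm => ?_, fun k hk => ?_⟩
    · rw [coeff_σ, hlow j m hm, mul_zero]
    · rw [coeff_σ, coeff_qpow_mul]
      exact hN j _ (by omega)
  | add _ _ hx hy =>
    refine ⟨fun m hm => ?_, fun k hk => ?_⟩
    · rw [map_add, hx.1 m hm, hy.1 m hm, add_zero]
    · rw [map_add, HahnSeries.coeff_add, hx.2 k hk, hy.2 k hk, add_zero]
  | sub _ _ hx hy =>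
    refine ⟨fun m hm => ?_, fun k hk => ?_⟩
    · rw [map_sub, hx.1 m hm, hy.1 m hm, sub_zero]
    · rw [map_sub, HahnSeries.coeff_sub, hx.2 k hk, hy.2 k hk, sub_zero]
  | z_mul _ hx =>
    have h : ∀ m ≤ n, PowerSeries.coeff m (z * _) = 0 := fun m hm => by
      rcases m with _ | m
      · exact coeff_z_mul_zero _
      · rw [coeff_z_mul_succ]
        exact hx.1 m (by omega)
    exact ⟨fun m hm => h m hm.le, fun k hk => by rw [h n le_rfl, HahnSeries.coeff_zero]⟩
  | q_mul _ hx =>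
    refine ⟨fun m hm => ?_, fun k hk => ?_⟩
    · rw [coeff_q_mul, hx.1 m hm, mul_zero]
    · rw [coeff_q_mul, coeff_qpow_mul]
      exact hx.2 _ (by omega)
  | shift _ hx =>
    refine ⟨fun m hm => ?_, fun k hk => ?_⟩
    · rw [coeff_σ, hx.1 m hm, mul_zero]
    · rw [coeff_σ, coeff_qpow_mul]
      exact hx.2 _ (by omega)

theorem eq_zero_of_shiftSpan {ι : Type} [Finite ι] (D : ι → ZQ)
    (h0 : ∀ i, PowerSeries.coeff 0 (D i) = 0) (h : ∀ i, ShiftSpan D (D i)) (i : ι) : D i = 0 := by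
  suffices H : ∀ n i, PowerSeries.coeff n (D i) = 0 from PowerSeries.ext fun n => H n i
  intro n
  induction n using Nat.strong_induction_on with
  | _ n ih =>
  rcases Nat.eq_zero_or_pos n with rfl | hn
  · exact h0
  -- Each Laurent series is bounded below, and finiteness of `ι` makes the bound uniform.
  have hbd : ∃ N : ℤ, ∀ i, ∀ k < N, (PowerSeries.coeff n (D i)).coeff k = 0 := by
    have hi : ∀ i, ∃ N : ℤ, ∀ k < N, (PowerSeries.coeff n (D i)).coeff k = 0 := fun i =>
      ⟨(PowerSeries.coeff n (D i)).order, fun k hk => HahnSeries.coeff_eq_zero_of_lt_order hk⟩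
    choose N hN using hi
    obtain ⟨M, hM⟩ := (Set.finite_range N).bddBelow
    exact ⟨M, fun i k hk => hN i k (hk.trans_le (hM ⟨i, rfl⟩))⟩
  obtain ⟨N, hN⟩ := hbd
  -- Each use of the equations raises the common order by `n ≥ 1`, hence by at least 1.
  have hstep : ∀ t : ℕ, ∀ i, ∀ k < N + t, (PowerSeries.coeff n (D i)).coeff k = 0 := by
    intro t
    induction t with
    | zero => simpa using hN
    | succ t iht =>
      intro i k hk
      refine ((h i).low_order (fun i m hm => ih m hm i) iht).2 k ?_
      push_cast at hk
      omega
  intro i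
  ext k
  rw [HahnSeries.coeff_zero]
  exact hstep (k - N + 1).toNat i k (by omega)

/-! ### Cylindric partitions: finiteness and weights -/

namespace CylindricPartition

variable {d : ℕ} {c : Fin (d + 1) → ℕ}

theorem ext_lam {L M : CylindricPartition c} (h : ∀ i j, L.lam i j = M.lam i j) : L = M := by
  cases L; cases M
  congr 1
  ext i j
  exact h i j

theorem finite_support (L : CylindricPartition c) (i : Fin (d + 1)) :
    (Function.support (L.lam i)).Finite := by
  obtain ⟨N, hN⟩ := L.eventually_zero i
  refine (Set.finite_Iio N).subset fun j hj => ?_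
  by_contra h
  exact hj (hN j (not_lt.mp h))

theorem max_le_iff (L : CylindricPartition c) (n : ℕ) : L.max ≤ n ↔ ∀ i, L.lam i 0 ≤ n := by
  simp [CylindricPartition.max]

theorem lam_le_max (L : CylindricPartition c) (i : Fin (d + 1)) (j : ℕ) : L.lam i j ≤ L.max :=
  (L.antitone i (Nat.zero_le j)).trans ((L.max_le_iff _).mp le_rfl i)

theorem mul_lam_le_weight (L : CylindricPartition c) (i : Fin (d + 1)) (j : ℕ) :
    (j + 1) * L.lam i j ≤ L.weight := by
  calc (j + 1) * L.lam i j ≤ ∑ k ∈ Finset.range (j + 1), L.lam i k := by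
        rw [← Finset.card_range (j + 1), ← smul_eq_mul, Finset.card_range]
        have := Finset.card_nsmul_le_sum (Finset.range (j + 1)) (L.lam i) (L.lam i j)
          fun k hk => L.antitone i (Nat.lt_succ_iff.mp (Finset.mem_range.mp hk))
        simpa using this
    _ ≤ ∑ᶠ k, L.lam i k := by
        rw [finsum_eq_sum_of_support_subset (s := Finset.range (j + 1) ∪ (L.finite_support
            i).toFinset)
          _ (by simp)]
        exact Finset.sum_le_sum_of_subset Finset.subset_union_left
    _ ≤ L.weight := Finset.single_le_sum (f := fun i => ∑ᶠ k, L.lam i k)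
        (fun _ _ => Nat.zero_le _) (Finset.mem_univ i)

/-- By `mul_lam_le_weight`, parts of a partition of weight `m` are at most `m` and vanish from index
`m` on. Finitely many bounded entries therefore determine it. -/
theorem finite_weight (m : ℕ) : {L : CylindricPartition c | L.weight = m}.Finite := by
  have hle : ∀ L : CylindricPartition c, L.weight = m → ∀ i j, L.lam i j < m + 1 := by
    rintro L rfl i j
    have := L.mul_lam_le_weight i j
    nlinarith [Nat.zero_le (j * L.lam i j)]
  refine Set.Finite.of_injOn (f := fun (L : CylindricPartition c) (i : Fin (d + 1)) (j : Fin m) =>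
    L.lam i j) (t := Set.pi Set.univ fun _ => Set.pi Set.univ fun _ => Set.Iio (m + 1)) ?_ ?_ ?_
  · intro L hL i _ j _
    exact hle L hL i j
  · intro L hL M hM h
    refine ext_lam fun i j => ?_
    by_cases hj : j < m
    · exact congrFun (congrFun h i) ⟨j, hj⟩
    · have h0 : ∀ N : CylindricPartition c, N.weight = m → N.lam i j = 0 := by
        rintro N rfl
        by_contra hne
        have := N.mul_lam_le_weight i j
        have h1 : 1 ≤ N.lam i j := Nat.one_le_iff_ne_zero.mpr hne
        nlinarith
      rw [h0 L hL, h0 M hM]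
  · exact Set.Finite.pi fun _ => Set.Finite.pi fun _ => Set.finite_Iio _

end CylindricPartition

/-! ### Generating functions of cylindric partitions -/

section Count

variable {d : ℕ} {c : Fin (d + 1) → ℕ}

/-- The generating function, by weight, of the cylindric partitions with a given property. -/
noncomputable def count (p : CylindricPartition c → Prop) : ℚ⟦X⟧ :=
  PowerSeries.mk fun m => (Nat.card {L : CylindricPartition c // p L ∧ L.weight = m} : ℚ)

open Classical in
theorem coeff_count (p : CylindricPartition c → Prop) (m : ℕ) :
    PowerSeries.coeff m (count p) =
      ∑ L ∈ (CylindricPartition.finite_weight (c := c) m).toFinset, if p L then (1 : ℚ) else 0 := by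
  rw [count, PowerSeries.coeff_mk, Finset.sum_boole]
  congr 1
  exact Nat.subtype_card _ fun L => by simp [and_comm]

theorem count_congr {p r : CylindricPartition c → Prop} (h : ∀ L, p L ↔ r L) :
    count p = count r := by
  rw [show p = r from funext fun L => propext (h L)]

theorem count_eq_add (p r : CylindricPartition c → Prop) :
    count p = count (fun L => p L ∧ r L) + count (fun L => p L ∧ ¬ r L) := by
  classical
  ext m
  rw [map_add, coeff_count, coeff_count, coeff_count, ← Finset.sum_add_distrib]
  refine Finset.sum_congr rfl fun L _ => ?_
  by_cases h1 : p L <;> by_cases h2 : r L <;> simp [h1, h2]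

/-- Inclusion–exclusion. -/
theorem sum_powerset_count (I : Finset (Fin (d + 1))) (p : CylindricPartition c → Prop)
    (r : Fin (d + 1) → CylindricPartition c → Prop) :
    ∑ J ∈ I.powerset, (-1) ^ J.card * count (fun L => p L ∧ ∀ i ∈ J, r i L) =
      count (fun L => p L ∧ ∀ i ∈ I, ¬ r i L) := by
  classical
  ext m
  rw [map_sum, coeff_count]
  have h1 : ∀ k : ℕ, (-1 : ℚ⟦X⟧) ^ k = PowerSeries.C ((-1) ^ k) := fun k => by simp
  simp only [h1, PowerSeries.coeff_C_mul, coeff_count, Finset.mul_sum]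
  rw [Finset.sum_comm]
  refine Finset.sum_congr rfl fun L _ => ?_
  by_cases hp : p L
  swap
  · simp [hp]
  -- For fixed `L` the signs are summed over all subsets of the set of `i ∈ I` with `r i L`; this
  -- gives 1 if that set is empty and 0 otherwise.
  have h2 : (I.filter (r · L)).powerset = I.powerset.filter fun J => ∀ i ∈ J, r i L := by
    ext J
    simp only [Finset.mem_powerset, Finset.mem_filter, Finset.subset_iff]
    exact ⟨fun h => ⟨fun i hi => (h hi).1, fun i hi => (h hi).2⟩,
      fun h i hi => ⟨h.1 hi, h.2 i hi⟩⟩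
  have h3 := congrArg (Int.cast (R := ℚ)) (Finset.sum_powerset_neg_one_pow_card (x := I.filter (r ·
      L)))
  rw [h2, Finset.sum_filter] at h3
  simp only [hp, true_and, mul_ite, mul_one, mul_zero]
  push_cast at h3
  rw [h3]
  simp only [Finset.filter_eq_empty_iff]

/-! ### Removing the largest parts -/

/-- The profile that remains after removing the first parts of the partitions indexed by `J`. -/
def removeProfile (c : Fin (d + 1) → ℕ) (J : Finset (Fin (d + 1))) (i : Fin (d + 1)) : ℕ :=
  if i ∈ J then (if i - 1 ∈ J then c i else c i - 1) else (if i - 1 ∈ J then c i + 1 else c i)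

theorem finsum_nat_eq_zero_add {f : ℕ → ℕ} (hf : ∃ N, ∀ j, N ≤ j → f j = 0) :
    ∑ᶠ j, f j = f 0 + ∑ᶠ j, f (j + 1) := by
  obtain ⟨N, hN⟩ := hf
  rw [finsum_eq_sum_of_support_subset (s := Finset.range (N + 1)),
    finsum_eq_sum_of_support_subset (s := Finset.range N), Finset.sum_range_succ', add_comm]
  · intro j hj
    by_contra h
    exact hj (hN _ (by simp at h; omega))
  · intro j hj
    by_contra h
    exact hj (hN _ (by simp at h; omega))

/-- Removing the first parts of the partitions indexed by `J`. -/
def removeParts (J : Finset (Fin (d + 1))) (hJ : ∀ i ∈ J, 0 < c i) (L : CylindricPartition c) :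
    CylindricPartition (removeProfile c J) where
  lam i j := if i ∈ J then L.lam i (j + 1) else L.lam i j
  antitone i j k h := by
    dsimp only
    split_ifs
    · exact L.antitone i (by omega)
    · exact L.antitone i h
  eventually_zero i := by
    obtain ⟨N, hN⟩ := L.eventually_zero i
    refine ⟨N, fun j hj => ?_⟩
    split_ifs
    · exact hN _ (by omega)
    · exact hN _ hj
  interlace i j := by
    have h0 := hJ (i + 1)
    have h1 := L.interlace i j
    have h2 := L.interlace i (j + 1)
    simp only [removeProfile, add_sub_cancel_right]
    split_ifs with a b b
    · rwa [add_right_comm] at h2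
    · have := h0 a
      rwa [show j + (c (i + 1) - 1) + 1 = j + c (i + 1) by omega]
    · rwa [show j + (c (i + 1) + 1) = j + 1 + c (i + 1) by omega]
    · exact h1

/-- Inserting a first part `n` into the partitions indexed by `J`. -/
def insertParts (J : Finset (Fin (d + 1))) (hJ : ∀ i ∈ J, 0 < c i) (n : ℕ)
    (L : CylindricPartition (removeProfile c J)) (hL : L.max ≤ n) : CylindricPartition c where
  lam i j := if i ∈ J then (if j = 0 then n else L.lam i (j - 1)) else L.lam i j
  antitone i j k h := by
    dsimp only
    split_ifs with a b b' b'
    · exact le_rfl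
    · omega
    · exact (L.lam_le_max _ _).trans hL
    · exact L.antitone i (by omega)
    · exact L.antitone i h
  eventually_zero i := by
    obtain ⟨N, hN⟩ := L.eventually_zero i
    refine ⟨N + 1, fun j hj => ?_⟩
    rw [if_neg (by omega : ¬ j = 0)]
    split_ifs
    · exact hN _ (by omega)
    · exact hN _ (by omega)
  interlace i j := by
    have h0 := hJ (i + 1)
    have h1 := L.interlace i j
    have h2 := L.interlace i (j - 1)
    have h3 := fun k => (L.lam_le_max (i + 1) k).trans hL
    simp only [removeProfile, add_sub_cancel_right] at h1 h2
    by_cases a : i + 1 ∈ J <;> by_cases b : i ∈ J <;> simp only [a, b, if_true, if_false] at h1 h2 ⊢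
    · split_ifs with u v v
      · exact le_rfl
      · omega
      · exact h3 _
      · rwa [show j + c (i + 1) - 1 = j - 1 + c (i + 1) by omega]
    -- Positivity of `c (i + 1)` is used here: the inserted part at index 0 is never compared with
    -- the unaltered partition `i`.
    · have := h0 a
      rw [if_neg (by omega)]
      rwa [show j + c (i + 1) - 1 = j + (c (i + 1) - 1) by omega]
    · split_ifs with u
      · exact h3 _
      · rwa [show j + c (i + 1) = j - 1 + (c (i + 1) + 1) by omega]
    · exact h1

theorem weight_removeParts (J : Finset (Fin (d + 1))) (hJ : ∀ i ∈ J, 0 < c i) {n : ℕ}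
    (L : CylindricPartition c) (hL : ∀ i ∈ J, L.lam i 0 = n) :
    L.weight = (removeParts J hJ L).weight + n * J.card := by
  have h : ∀ i, ∑ᶠ j, L.lam i j =
      ∑ᶠ j, (removeParts J hJ L).lam i j + if i ∈ J then n else 0 := by
    intro i
    simp only [removeParts]
    split_ifs with hi
    · rw [finsum_nat_eq_zero_add (L.eventually_zero i), hL i hi, add_comm]
    · rfl
  simp only [CylindricPartition.weight, h, Finset.sum_add_distrib]
  simp [mul_comm]

theorem max_removeParts_le (J : Finset (Fin (d + 1))) (hJ : ∀ i ∈ J, 0 < c i)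
    (L : CylindricPartition c) : (removeParts J hJ L).max ≤ L.max := by
  rw [CylindricPartition.max_le_iff]
  intro i
  simp only [removeParts]
  split_ifs <;> exact L.lam_le_max _ _

/-- Removing first parts equal to `n`, as a bijection. -/
def removeEquiv (J : Finset (Fin (d + 1))) (hJ : ∀ i ∈ J, 0 < c i) (n : ℕ) :
    {L : CylindricPartition c // L.max ≤ n ∧ ∀ i ∈ J, L.lam i 0 = n} ≃
      {L : CylindricPartition (removeProfile c J) // L.max ≤ n} where
  toFun L := ⟨removeParts J hJ L, (max_removeParts_le J hJ _).trans L.2.1⟩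
  invFun L := ⟨insertParts J hJ n L L.2, by
    rw [CylindricPartition.max_le_iff]
    intro i
    simp only [insertParts, if_true]
    split_ifs
    · exact le_rfl
    · exact (L.1.lam_le_max _ _).trans L.2, fun i hi => by simp [insertParts, hi]⟩
  left_inv L := by
    refine Subtype.ext (CylindricPartition.ext_lam fun i j => ?_)
    simp only [insertParts, removeParts]
    split_ifs with h1 h2
    · rw [h2, L.2.2 i h1]
    · rw [show j - 1 + 1 = j by omega]
    · rfl
  right_inv L := by
    refine Subtype.ext (CylindricPartition.ext_lam fun i j => ?_)
    by_cases h : i ∈ J <;> simp [insertParts, removeParts, h]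

theorem count_first_parts (J : Finset (Fin (d + 1))) (hJ : ∀ i ∈ J, 0 < c i) (n : ℕ) :
    count (fun L : CylindricPartition c => L.max ≤ n ∧ ∀ i ∈ J, L.lam i 0 = n) =
      PowerSeries.X ^ (n * J.card) *
        count (fun L : CylindricPartition (removeProfile c J) => L.max ≤ n) := by
  ext m
  rw [PowerSeries.coeff_X_pow_mul', count, PowerSeries.coeff_mk]
  split_ifs with hm
  · rw [count, PowerSeries.coeff_mk]
    congr 1
    refine Nat.card_congr (((Equiv.subtypeSubtypeEquivSubtypeInter _ _).symm.trans
      ((removeEquiv J hJ n).subtypeEquiv fun L => ?_)).trans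
      (Equiv.subtypeSubtypeEquivSubtypeInter _
        fun L : CylindricPartition (removeProfile c J) => L.weight = m - n * J.card))
    rw [weight_removeParts J hJ L.1 L.2.2]
    simp only [removeEquiv, Equiv.coe_fn_mk]
    omega
  · rw [Nat.cast_eq_zero, Nat.card_eq_zero]
    refine Or.inl ⟨fun ⟨L, h, hw⟩ => hm ?_⟩
    rw [← hw, weight_removeParts J hJ L h.2]
    exact Nat.le_add_left _ _

open Fin.NatCast Fin.CommRing in
/-- The recursion obtained by removing the largest parts. -/
theorem sum_removeProfile (I : Finset (Fin (d + 1))) (hI : ∀ i, i ∈ I ↔ 0 < c i)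
    (hne : I.Nonempty) (n : ℕ) :
    ∑ J ∈ I.powerset, (-1) ^ J.card * (PowerSeries.X ^ (n * J.card) *
        count (fun L : CylindricPartition (removeProfile c J) => L.max ≤ n)) =
      count (fun L : CylindricPartition c => L.max < n) := by
  have h : ∀ J ∈ I.powerset, (-1) ^ J.card * (PowerSeries.X ^ (n * J.card) *
        count (fun L : CylindricPartition (removeProfile c J) => L.max ≤ n)) =
      (-1) ^ J.card * count (fun L : CylindricPartition c => L.max ≤ n ∧
        ∀ i ∈ J, L.lam i 0 = n) := fun J hJ => by
    rw [count_first_parts J fun i hi => (hI i).mp (Finset.mem_powerset.mp hJ hi)]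
  rw [Finset.sum_congr rfl h,
    sum_powerset_count I (fun L : CylindricPartition c => L.max ≤ n) fun i L => L.lam i 0 = n]
  refine count_congr fun L => ⟨fun ⟨h1, h2⟩ => ?_, fun h1 => ⟨h1.le, fun i _ => ?_⟩⟩
  · refine lt_of_le_of_ne h1 fun hmax => ?_
    obtain ⟨i₀, -, hi₀⟩ := Finset.exists_mem_eq_sup Finset.univ Finset.univ_nonempty
      fun i => L.lam i 0
    have hi : L.lam i₀ 0 = n := hi₀.symm.trans hmax
    -- If the maximum `n` is attained at `i₀` but at no index of `I`, then `c i₀ = 0`, and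
    -- interlacing pushes the value `n` to the index before. Going round the cycle reaches `I`, a
    -- contradiction.
    have hall : ∀ k : ℕ, L.lam (i₀ - (k : Fin (d + 1))) 0 = n := by
      intro k
      induction k with
      | zero => simpa using hi
      | succ k ih =>
        have hc : c (i₀ - (k : Fin (d + 1))) = 0 := by
          by_contra hc
          exact h2 _ ((hI _).mpr (Nat.pos_of_ne_zero hc)) ih
        have h3 := L.interlace (i₀ - (k + 1 : ℕ)) 0
        rw [show i₀ - ((k + 1 : ℕ) : Fin (d + 1)) + 1 = i₀ - (k : Fin (d + 1)) by push_cast; abel,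
            hc, ih] at h3
        exact le_antisymm ((L.lam_le_max _ _).trans h1) h3
    obtain ⟨i, hi⟩ := hne
    refine h2 i hi ?_
    have := hall (i₀ - i).val
    rwa [Fin.cast_val_eq_self, sub_sub_cancel] at this
  · exact ((L.lam_le_max i 0).trans_lt h1).ne

end Count

/-! ### Functional equations of `H` -/

section

variable {d : ℕ}

/-- The generating function of the cylindric partitions of profile `c`, where `z` marks an upper
bound of the parts. -/
noncomputable def G (c : Fin (d + 1) → ℕ) : ZQ :=
  PowerSeries.mk fun n => toLaurent (count fun L : CylindricPartition c => L.max ≤ n)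

theorem map_F (c : Fin (d + 1) → ℕ) : PowerSeries.map toLaurent (F c) = (1 - z) * G c := by
  have hF : ∀ n, PowerSeries.coeff n (F c) = count fun L : CylindricPartition c => L.max = n :=
    fun n => by rw [F, PowerSeries.coeff_mk]; rfl
  ext1 n
  rw [PowerSeries.coeff_map, hF, sub_mul, one_mul, map_sub]
  rcases n with _ | n
  · rw [coeff_z_mul_zero, sub_zero, G, PowerSeries.coeff_mk]
    simp only [Nat.le_zero]
  · rw [coeff_z_mul_succ, G, PowerSeries.coeff_mk, PowerSeries.coeff_mk,
      count_eq_add (fun L : CylindricPartition c => L.max ≤ n + 1) fun L => L.max = n + 1, map_add,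
      count_congr (p := fun L : CylindricPartition c => L.max ≤ n + 1 ∧ L.max = n + 1)
        (r := fun L => L.max = n + 1) fun L => by omega,
      count_congr (p := fun L : CylindricPartition c => L.max ≤ n + 1 ∧ ¬ L.max = n + 1)
        (r := fun L => L.max ≤ n) fun L => by omega, add_sub_cancel_right]

theorem coeff_σ_iterate (k : ℕ) (f : ZQ) (n : ℕ) :
    PowerSeries.coeff n (σ^[k] f) = qpow (n * k : ℕ) * PowerSeries.coeff n f := by
  induction k with
  | zero => simp [qpow_zero]
  | succ k ih =>
    rw [Function.iterate_succ_apply', coeff_σ, ih, ← mul_assoc, ← qpow_add]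
    congr 2
    push_cast
    ring

/-- This is `sum_removeProfile` for all `n` at once: `σ^[k]` puts `q^(n k)` on the coefficient of
`z^n`, and the bound `max < n` shifts the series by one power of `z`. -/
theorem sum_σ_iterate_G (c : Fin (d + 1) → ℕ) (I : Finset (Fin (d + 1)))
    (hI : ∀ i, i ∈ I ↔ 0 < c i) (hne : I.Nonempty) :
    ∑ J ∈ I.powerset, (-1) ^ J.card * σ^[J.card] (G (removeProfile c J)) = z * G c := by
  ext1 n
  have h1 : ∀ k : ℕ, (-1 : ZQ) ^ k = PowerSeries.C ((-1) ^ k) := fun k => by simp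
  have h := congrArg toLaurent (sum_removeProfile I hI hne n)
  rw [map_sum] at h
  rw [map_sum]
  simp only [h1, PowerSeries.coeff_C_mul, coeff_σ_iterate, G, PowerSeries.coeff_mk, qpow_natCast]
  simp only [map_mul, map_pow, map_neg, map_one] at h ⊢
  rw [h]
  rcases n with _ | n
  · rw [coeff_z_mul_zero, ← map_zero toLaurent]
    congr 1
    ext m
    simp [count]
  · rw [coeff_z_mul_succ, PowerSeries.coeff_mk]
    simp only [Nat.lt_succ_iff]

/-- `(zq; q)_∞ / (q)_∞` as an element of `ZQ`. -/
noncomputable def prefactor : ZQ := PowerSeries.map toLaurent (zqPochInf * PowerSeries.C qPochInf⁻¹)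

theorem H_eq (c : Fin (d + 1) → ℕ) : H c = prefactor * ((1 - z) * G c) := by
  rw [H, map_mul, map_F]; rfl

/-! ### The prefactor under `z ↦ z q`. -/

theorem rescale_C {R : Type} [CommSemiring R] (a b : R) :
    PowerSeries.rescale a (PowerSeries.C b) = PowerSeries.C b := by
  ext n
  rw [PowerSeries.coeff_rescale, PowerSeries.coeff_C]
  split_ifs with h
  · rw [h, pow_zero, one_mul]
  · rw [mul_zero]

theorem zqPoch_succ (N : ℕ) : zqPoch (N + 1) =
    (1 - PowerSeries.X * PowerSeries.C PowerSeries.X) *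
      PowerSeries.rescale PowerSeries.X (zqPoch N) := by
  have h : ∀ t : ℕ, PowerSeries.rescale (PowerSeries.X : ℚ⟦X⟧)
      (1 - PowerSeries.X * PowerSeries.C (PowerSeries.X ^ (t + 1))) =
      1 - PowerSeries.X * PowerSeries.C (PowerSeries.X ^ (t + 1 + 1)) := fun t => by
    rw [map_sub, map_one, map_mul, PowerSeries.rescale_X, rescale_C,
      pow_succ _ (t + 1), map_mul]
    ring
  rw [zqPoch, Finset.prod_range_succ', zqPoch, map_prod, mul_comm]
  simp only [h, zero_add, pow_one]

theorem coeff_zqPoch_of_le {n m N : ℕ} (h : m ≤ N) :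
    PowerSeries.coeff m (PowerSeries.coeff n (zqPoch N)) =
      PowerSeries.coeff m (PowerSeries.coeff n (zqPoch m)) := by
  induction N, h using Nat.le_induction with
  | base => rfl
  | succ N hN ih =>
    rw [zqPoch, Finset.prod_range_succ, ← zqPoch, mul_sub, mul_one, map_sub, map_sub, ih,
      ← mul_assoc, PowerSeries.coeff_mul_C, PowerSeries.coeff_mul_X_pow', if_neg (by omega),
      sub_zero]

theorem zqPochInf_eq : zqPochInf = (1 - PowerSeries.X * PowerSeries.C PowerSeries.X) *
    PowerSeries.rescale PowerSeries.X zqPochInf := by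
  ext n m
  have h0 : ∀ n k, k ≤ m → PowerSeries.coeff k (PowerSeries.coeff n zqPochInf) =
      -- Up to `q^m` the infinite product may be replaced by the one with `m` factors, for which
      -- `zqPoch_succ` splits off `1 - z q`.
      PowerSeries.coeff k (PowerSeries.coeff n (zqPoch m)) := fun n k hk => by
    rw [coeff_zqPoch_of_le hk, zqPochInf, PowerSeries.coeff_mk, PowerSeries.coeff_mk]
  rw [h0 n m le_rfl, ← coeff_zqPoch_of_le (Nat.le_succ m), zqPoch_succ, sub_mul, sub_mul, one_mul,
    one_mul, map_sub, map_sub, map_sub, map_sub, PowerSeries.coeff_rescale,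
    PowerSeries.coeff_rescale, PowerSeries.coeff_X_pow_mul', PowerSeries.coeff_X_pow_mul']
  congr 1
  · split_ifs
    · rw [h0 _ _ (by omega)]
    · rfl
  · rcases n with _ | n
    · rw [mul_assoc, mul_assoc, PowerSeries.coeff_zero_X_mul, PowerSeries.coeff_zero_X_mul]
    · rw [mul_assoc, mul_assoc, PowerSeries.coeff_succ_X_mul, PowerSeries.coeff_succ_X_mul,
        PowerSeries.coeff_C_mul, PowerSeries.coeff_C_mul, PowerSeries.coeff_rescale,
        PowerSeries.coeff_rescale]
      simp only [← mul_assoc, ← pow_succ', PowerSeries.coeff_X_pow_mul']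
      split_ifs
      · rw [h0 _ _ (by omega)]
      · rfl

theorem prefactor_eq : prefactor = (1 - z * q) * σ prefactor := by
  have hX : toLaurent PowerSeries.X = qpow 1 := by
    rw [← pow_one PowerSeries.X, ← qpow_natCast 1]; rfl
  have hq : q = PowerSeries.C (qpow 1) := rfl
  have hr : ∀ f : PowerSeries ℚ⟦X⟧, PowerSeries.map toLaurent (PowerSeries.rescale PowerSeries.X f)
      =
      σ (PowerSeries.map toLaurent f) := fun f => by
    ext1 n
    rw [coeff_σ, PowerSeries.coeff_map, PowerSeries.coeff_rescale, PowerSeries.coeff_map, map_mul,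
      qpow_natCast]
  have h := congrArg (PowerSeries.map toLaurent) zqPochInf_eq
  rw [map_mul, hr, map_sub, map_one, map_mul, PowerSeries.map_X, PowerSeries.map_C, hX] at h
  have hC : σ (PowerSeries.C (toLaurent qPochInf⁻¹)) = PowerSeries.C (toLaurent qPochInf⁻¹) :=
    rescale_C _ _
  rw [prefactor, map_mul, map_mul, PowerSeries.map_C, hC, hq, z, ← mul_assoc, ← h]

/-- The factor `1 - z q` lost by the prefactor under `σ` is the one by which `σ (F c)` and `σ (G c)`
differ. Further shifts leave the polynomial factors of the next two lemmas. -/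
theorem prefactor_mul_σ_G (c : Fin (d + 1) → ℕ) : prefactor * σ (G c) = σ (H c) := by
  rw [H_eq, map_mul, map_mul, map_sub, map_one, σ_z]
  nth_rw 1 [prefactor_eq]
  ring

theorem prefactor_mul_σ_σ_G (c : Fin (d + 1) → ℕ) :
    prefactor * σ (σ (G c)) = (1 - z * q) * σ (σ (H c)) := by
  rw [← prefactor_mul_σ_G, map_mul]
  nth_rw 1 [prefactor_eq]
  ring

theorem prefactor_mul_σ_σ_σ_G (c : Fin (d + 1) → ℕ) :
    prefactor * σ (σ (σ (G c))) = (1 - z * q) * ((1 - z * q * q) * σ (σ (σ (H c)))) := by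
  have h := congrArg σ (prefactor_mul_σ_σ_G c)
  rw [map_mul, map_mul, map_sub, map_one, map_mul, σ_z, σ_q] at h
  rw [← h]
  nth_rw 1 [prefactor_eq]
  ring

end

/-! ### Functional equations of `H` in rank 3, by the number of positive entries of the profile. -/

theorem H_succ_zero_zero (a : ℕ) : H ![a + 1, 0, 0] = σ (H ![a, 1, 0]) := by
  have h := sum_σ_iterate_G ![a + 1, 0, 0] {0} (by intro i; fin_cases i <;> simp) ⟨0, by simp⟩
  have hP : ({0} : Finset (Fin 3)).powerset = {∅, {0}} := by decide
  have e0 : removeProfile ![a + 1, 0, 0] ∅ = ![a + 1, 0, 0] := by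
    funext i; fin_cases i <;> rfl
  have e1 : removeProfile ![a + 1, 0, 0] {0} = ![a, 1, 0] := by
    funext i; fin_cases i <;> rfl
  rw [hP] at h
  repeat rw [Finset.sum_insert (by decide)] at h
  simp only [Finset.sum_singleton, Finset.card_empty, Finset.card_singleton,
    Function.iterate_succ_apply', Function.iterate_zero_apply, e0, e1] at h
  rw [H_eq, ← prefactor_mul_σ_G]
  linear_combination prefactor * h

theorem H_succ_succ_zero (a b : ℕ) : H ![a + 1, b + 1, 0] =
    σ (H ![a, b + 2, 0]) + σ (H ![a + 1, b, 1]) - (1 - z * q) * σ (σ (H ![a, b + 1, 1])) := by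
  have h := sum_σ_iterate_G ![a + 1, b + 1, 0] {0, 1} (by intro i; fin_cases i <;> simp)
    ⟨0, by simp⟩
  have hP : ({0, 1} : Finset (Fin 3)).powerset = {∅, {0}, {1}, {0, 1}} := by decide
  have e0 : removeProfile ![a + 1, b + 1, 0] ∅ = ![a + 1, b + 1, 0] := by
    funext i; fin_cases i <;> rfl
  have e1 : removeProfile ![a + 1, b + 1, 0] {0} = ![a, b + 2, 0] := by
    funext i; fin_cases i <;> rfl
  have e2 : removeProfile ![a + 1, b + 1, 0] {1} = ![a + 1, b, 1] := by
    funext i; fin_cases i <;> rfl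
  have e3 : removeProfile ![a + 1, b + 1, 0] {0, 1} = ![a, b + 1, 1] := by
    funext i; fin_cases i <;> rfl
  have c2 : ({0, 1} : Finset (Fin 3)).card = 2 := by decide
  rw [hP] at h
  repeat rw [Finset.sum_insert (by decide)] at h
  simp only [Finset.sum_singleton, Finset.card_empty, Finset.card_singleton, c2,
    Function.iterate_succ_apply', Function.iterate_zero_apply, e0, e1, e2, e3] at h
  rw [H_eq, ← prefactor_mul_σ_σ_G, ← prefactor_mul_σ_G, ← prefactor_mul_σ_G]
  linear_combination prefactor * h

theorem H_succ_succ_succ (a b c : ℕ) : H ![a + 1, b + 1, c + 1] =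
    σ (H ![a, b + 2, c + 1]) + σ (H ![a + 1, b, c + 2]) + σ (H ![a + 2, b + 1, c]) -
      (1 - z * q) * (σ (σ (H ![a, b + 1, c + 2])) + σ (σ (H ![a + 2, b, c + 1])) +
        σ (σ (H ![a + 1, b + 2, c]))) +
      (1 - z * q) * ((1 - z * q * q) * σ (σ (σ (H ![a + 1, b + 1, c + 1])))) := by
  have h := sum_σ_iterate_G ![a + 1, b + 1, c + 1] {0, 1, 2} (by intro i; fin_cases i <;> simp)
    ⟨0, by simp⟩
  have hP : ({0, 1, 2} : Finset (Fin 3)).powerset =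
    {∅, {0}, {1}, {2}, {0, 1}, {1, 2}, {0, 2}, {0, 1, 2}} := by decide
  have e0 : removeProfile ![a + 1, b + 1, c + 1] ∅ = ![a + 1, b + 1, c + 1] := by
    funext i; fin_cases i <;> rfl
  have e1 : removeProfile ![a + 1, b + 1, c + 1] {0} = ![a, b + 2, c + 1] := by
    funext i; fin_cases i <;> rfl
  have e2 : removeProfile ![a + 1, b + 1, c + 1] {1} = ![a + 1, b, c + 2] := by
    funext i; fin_cases i <;> rfl
  have e3 : removeProfile ![a + 1, b + 1, c + 1] {2} = ![a + 2, b + 1, c] := by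
    funext i; fin_cases i <;> rfl
  have e4 : removeProfile ![a + 1, b + 1, c + 1] {0, 1} = ![a, b + 1, c + 2] := by
    funext i; fin_cases i <;> rfl
  have e5 : removeProfile ![a + 1, b + 1, c + 1] {1, 2} = ![a + 2, b, c + 1] := by
    funext i; fin_cases i <;> rfl
  have e6 : removeProfile ![a + 1, b + 1, c + 1] {0, 2} = ![a + 1, b + 2, c] := by
    funext i; fin_cases i <;> rfl
  have e7 : removeProfile ![a + 1, b + 1, c + 1] {0, 1, 2} = ![a + 1, b + 1, c + 1] := by
    funext i; fin_cases i <;> rfl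
  have c4 : ({0, 1} : Finset (Fin 3)).card = 2 := by decide
  have c5 : ({1, 2} : Finset (Fin 3)).card = 2 := by decide
  have c6 : ({0, 2} : Finset (Fin 3)).card = 2 := by decide
  have c7 : ({0, 1, 2} : Finset (Fin 3)).card = 3 := by decide
  rw [hP] at h
  repeat rw [Finset.sum_insert (by decide)] at h
  simp only [Finset.sum_singleton, Finset.card_empty, Finset.card_singleton, c4, c5, c6, c7,
    Function.iterate_succ_apply', Function.iterate_zero_apply, e0, e1, e2, e3, e4, e5, e6, e7] at h
  rw [mul_add, mul_add, ← prefactor_mul_σ_σ_σ_G]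
  simp only [← prefactor_mul_σ_σ_G]
  rw [H_eq, ← prefactor_mul_σ_G, ← prefactor_mul_σ_G, ← prefactor_mul_σ_G]
  linear_combination prefactor * h

/-! ### Constant term and cyclic symmetry of `H`. -/

theorem coeff_zero_H {d : ℕ} (c : Fin (d + 1) → ℕ) :
    PowerSeries.coeff 0 (H c) = toLaurent qPochInf⁻¹ := by
  have hz : PowerSeries.coeff 0 zqPochInf = 1 := by
    ext m
    rw [zqPochInf, PowerSeries.coeff_mk, PowerSeries.coeff_mk,
      PowerSeries.coeff_zero_eq_constantCoeff_apply, zqPoch, map_prod]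
    simp
  have hF : PowerSeries.coeff 0 (F c) = 1 := by
    ext m
    rw [F, PowerSeries.coeff_mk, PowerSeries.coeff_mk, PowerSeries.coeff_one]
    -- Largest part 0 leaves only the zero array, so the constant term of `F c` is 1.
    have hz : ∀ L : CylindricPartition c, L.max = 0 → ∀ i j, L.lam i j = 0 := fun L hL i j =>
      Nat.le_zero.mp (hL ▸ L.lam_le_max i j)
    have hw : ∀ L : CylindricPartition c, L.max = 0 → L.weight = 0 := fun L hL => by
      simp [CylindricPartition.weight, hz L hL]
    split_ifs with hm
    · rw [Nat.cast_eq_one, Nat.card_eq_one_iff_unique]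
      refine ⟨⟨fun L M => Subtype.ext (CylindricPartition.ext_lam fun i j => ?_)⟩, ⟨⟨⟨fun _ _ => 0,
          fun _ _ _ _ => le_rfl,
        fun _ => ⟨0, fun _ _ => rfl⟩, fun _ _ => le_rfl⟩, ?_, ?_⟩⟩⟩
      · rw [hz _ L.2.1, hz _ M.2.1]
      · simp [CylindricPartition.max]
      · simp [CylindricPartition.weight, hm]
    · rw [Nat.cast_eq_zero, Nat.card_eq_zero]
      exact Or.inl ⟨fun ⟨L, h, hwt⟩ => hm (hwt ▸ hw L h)⟩
  rw [H, PowerSeries.coeff_map, PowerSeries.coeff_zero_eq_constantCoeff_apply, map_mul, map_mul,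
    ← PowerSeries.coeff_zero_eq_constantCoeff_apply, ←
        PowerSeries.coeff_zero_eq_constantCoeff_apply,
    PowerSeries.coeff_mul_C, hz, hF, one_mul, map_one, mul_one]

/-- Rotating a cylindric partition. -/
def rotEquiv (c : Fin 3 → ℕ) (j : Fin 3) : CylindricPartition c ≃ CylindricPartition (rot c j) where
  toFun L := ⟨fun i => L.lam (i + j), fun i => L.antitone _, fun i => L.eventually_zero _,
    fun i k => by
      have := L.interlace (i + j) k
      rwa [add_right_comm] at this⟩
  invFun L := ⟨fun i => L.lam (i - j), fun i => L.antitone _, fun i => L.eventually_zero _,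
    fun i k => by
      have := L.interlace (i - j) k
      rwa [sub_add_eq_add_sub, rot, sub_add_cancel] at this⟩
  left_inv L := CylindricPartition.ext_lam fun i k => by simp
  right_inv L := CylindricPartition.ext_lam fun i k => by simp

theorem H_rot (c : Fin 3 → ℕ) (j : Fin 3) : H (rot c j) = H c := by
  have hF : F (rot c j) = F c := by
    ext n m
    rw [F, F, PowerSeries.coeff_mk, PowerSeries.coeff_mk, PowerSeries.coeff_mk,
      PowerSeries.coeff_mk]
    congr 1
    refine (Nat.card_congr ((rotEquiv c j).subtypeEquiv fun L => ?_)).symm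
    have hmax : (rotEquiv c j L).max = L.max := by
      refine le_antisymm ((CylindricPartition.max_le_iff _ _).mpr fun i => L.lam_le_max _ _)
        ((CylindricPartition.max_le_iff _ _).mpr fun i => ?_)
      have := (rotEquiv c j L).lam_le_max (i - j) 0
      simpa [rotEquiv] using this
    have hw : (rotEquiv c j L).weight = L.weight :=
      Equiv.sum_comp (Equiv.addRight j) fun i => ∑ᶠ k, L.lam i k
    rw [hmax, hw]
  rw [H, H, hF]

/-! ### Comparison of `H` with the sums -/

section

variable {ι : Type} {D : ι → ZQ}

theorem ShiftSpan.one_sub_z_mul_q {x : ZQ} (hx : ShiftSpan D x) :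
    ShiftSpan D ((1 - z * q) * x) := by
  rw [show (1 - z * q) * x = x - z * (q * x) by ring]
  exact hx.sub hx.q_mul.z_mul

theorem ShiftSpan.one_sub_z_mul_q_mul_q {x : ZQ} (hx : ShiftSpan D x) :
    ShiftSpan D ((1 - z * q * q) * x) := by
  rw [show (1 - z * q * q) * x = x - z * (q * (q * x)) by ring]
  exact hx.sub hx.q_mul.q_mul.z_mul

/-- This lemma and the next two treat the three shapes of functional equation. Since `H` and its
candidate satisfy the same linear equation, their difference is built from shifted differences, as
`eq_zero_of_shiftSpan` requires. -/
theorem shiftSpan_sub_of_eq₁ {x y a a' : ZQ} (hx : x = σ a) (hy : y = σ a')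
    (ha : ShiftSpan D (σ (a - a'))) : ShiftSpan D (x - y) := by
  rwa [hx, hy, ← map_sub]

theorem shiftSpan_sub_of_eq₂ {x y a a' b b' c c' : ZQ}
    (hx : x = σ a + σ b - (1 - z * q) * σ (σ c)) (hy : y = σ a' + σ b' - (1 - z * q) * σ (σ c'))
    (ha : ShiftSpan D (σ (a - a'))) (hb : ShiftSpan D (σ (b - b')))
    (hc : ShiftSpan D (σ (c - c'))) : ShiftSpan D (x - y) := by
  have h := (ha.add hb).sub hc.shift.one_sub_z_mul_q
  simp only [map_sub] at h
  rw [hx, hy]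
  convert h using 1
  ring

theorem shiftSpan_sub_of_eq₃ {x y a a' b b' c c' d d' e e' f f' g g' : ZQ}
    (hx : x = σ a + σ b + σ c - (1 - z * q) * (σ (σ d) + σ (σ e) + σ (σ f)) +
      (1 - z * q) * ((1 - z * q * q) * σ (σ (σ g))))
    (hy : y = σ a' + σ b' + σ c' - (1 - z * q) * (σ (σ d') + σ (σ e') + σ (σ f')) +
      (1 - z * q) * ((1 - z * q * q) * σ (σ (σ g'))))
    (ha : ShiftSpan D (σ (a - a'))) (hb : ShiftSpan D (σ (b - b')))
    (hc : ShiftSpan D (σ (c - c'))) (hd : ShiftSpan D (σ (d - d')))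
    (he : ShiftSpan D (σ (e - e'))) (hf : ShiftSpan D (σ (f - f')))
    (hg : ShiftSpan D (σ (g - g'))) : ShiftSpan D (x - y) := by
  have h := (((ha.add hb).add hc).sub
    ((hd.shift.add he.shift).add hf.shift).one_sub_z_mul_q).add
    hg.shift.shift.one_sub_z_mul_q_mul_q.one_sub_z_mul_q
  simp only [map_sub] at h
  rw [hx, hy]
  convert h using 1
  ring

end

/-! ### Solving the systems for `ℓ = 2, 4, 5`, with one unknown per rotation class of profiles. -/

theorem H_rotate (a b c : ℕ) : H ![b, c, a] = H ![a, b, c] := by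
  rw [← H_rot ![a, b, c] 1]
  congr 1
  funext i
  fin_cases i <;> rfl

theorem coeff_zero_q_mul_one_sub_z_mul (f : ZQ) :
    PowerSeries.coeff 0 (q * (1 - z) * f) = qpow 1 * PowerSeries.coeff 0 f := by
  rw [mul_assoc, coeff_q_mul, sub_mul, one_mul, map_sub, coeff_z_mul_zero, sub_zero]

theorem coeff_zero_H_sub {d : ℕ} (c : Fin (d + 1) → ℕ) {T : ZQ}
    (h : PowerSeries.coeff 0 T = toLaurent qPochInf⁻¹) : PowerSeries.coeff 0 (H c - T) = 0 := by
  rw [map_sub, coeff_zero_H, h, sub_self]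

theorem H_eq_S5 :
    H ![2, 0, 0] = S5 1 1 ∧
    H ![1, 1, 0] = S5 0 1 := by
  have r011 : H ![0, 1, 1] = H ![1, 1, 0] := (H_rotate 0 1 1).symm
  have r020 : H ![0, 2, 0] = H ![2, 0, 0] := (H_rotate 0 2 0).symm
  have r101 : H ![1, 0, 1] = H ![1, 1, 0] := H_rotate 1 1 0
  have h200 : H ![2, 0, 0] = σ (H ![1, 1, 0]) :=
    H_succ_zero_zero 1
  have t200 : S5 1 1 = σ (S5 0 1) := by
    simp only [σ_S5, Int.reduceAdd]
  have h110 : H ![1, 1, 0] = σ (H ![0, 2, 0]) + σ (H ![1, 0, 1]) -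
      (1 - z * q) * σ (σ (H ![0, 1, 1])) :=
    H_succ_succ_zero 0 0
  rw [r020, r101, r011] at h110
  have t110 : S5 0 1 = σ (S5 1 1) + σ (S5 0 1) -
      (1 - z * q) * σ (σ (S5 0 1)) := by
    simp only [σ_S5, Int.reduceAdd]
    linear_combination S5_funeq₁₁₀
  obtain ⟨D, hD⟩ : ∃ D : Fin 2 → ZQ, D = ![H ![2, 0, 0] - S5 1 1, H ![1, 1, 0] - S5 0 1] :=
    ⟨_, rfl⟩
  have d0 : D 0 = H ![2, 0, 0] - S5 1 1 := by rw [hD]; rfl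
  have d1 : D 1 = H ![1, 1, 0] - S5 0 1 := by rw [hD]; rfl
  have b0 : ShiftSpan D (σ (H ![2, 0, 0] - S5 1 1)) := d0 ▸ .base 0
  have b1 : ShiftSpan D (σ (H ![1, 1, 0] - S5 0 1)) := d1 ▸ .base 1
  have key := eq_zero_of_shiftSpan D ?_ ?_
  · exact ⟨sub_eq_zero.mp (d0 ▸ key 0), sub_eq_zero.mp (d1 ▸ key 1)⟩
  · simp only [Fin.forall_fin_succ, IsEmpty.forall_iff, and_true]
    refine ⟨?_, ?_⟩
    · refine (congrArg _ d0).trans (coeff_zero_H_sub _ ?_)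
      exact coeff_zero_S5_one _
    · refine (congrArg _ d1).trans (coeff_zero_H_sub _ ?_)
      exact coeff_zero_S5_one _
  · simp only [Fin.forall_fin_succ, IsEmpty.forall_iff, and_true]
    refine ⟨?_, ?_⟩
    · exact d0 ▸ shiftSpan_sub_of_eq₁ h200 t200 b1
    · exact d1 ▸ shiftSpan_sub_of_eq₂ h110 t110 b0 b1 b1

/-- The equations for `(4,0,0)`, `(3,1,0)` and `(3,0,1)` hold identically for the candidates. Only
`(2,1,1)` and `(2,2,0)` need relations between the sums. -/
theorem H_eq_S7 :
    H ![4, 0, 0] = S7 1 1 ∧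
    H ![3, 1, 0] = S7 0 1 ∧
    H ![3, 0, 1] = S7 1 0 - q * (1 - z) * S7 2 1 ∧
    H ![2, 1, 1] = S7 0 0 - q * S7 1 1 ∧
    H ![2, 2, 0] = S7 (-1) 1 - z * S7 1 0 := by
  have r031 : H ![0, 3, 1] = H ![3, 1, 0] := (H_rotate 0 3 1).symm
  have r040 : H ![0, 4, 0] = H ![4, 0, 0] := (H_rotate 0 4 0).symm
  have r112 : H ![1, 1, 2] = H ![2, 1, 1] := H_rotate 2 1 1
  have r121 : H ![1, 2, 1] = H ![2, 1, 1] := (H_rotate 1 2 1).symm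
  have r130 : H ![1, 3, 0] = H ![3, 0, 1] := (H_rotate 1 3 0).symm
  have r202 : H ![2, 0, 2] = H ![2, 2, 0] := H_rotate 2 2 0
  have h400 : H ![4, 0, 0] = σ (H ![3, 1, 0]) :=
    H_succ_zero_zero 3
  have t400 : S7 1 1 = σ (S7 0 1) := by
    simp only [σ_S7, Int.reduceAdd]
  have h310 : H ![3, 1, 0] = σ (H ![2, 2, 0]) + σ (H ![3, 0, 1]) -
      (1 - z * q) * σ (σ (H ![2, 1, 1])) :=
    H_succ_succ_zero 2 0
  have t310 : S7 0 1 = σ (S7 (-1) 1 - z * S7 1 0) + σ (S7 1 0 - q * (1 - z) * S7 2 1) -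
      (1 - z * q) * σ (σ (S7 0 0 - q * S7 1 1)) := by
    simp only [map_sub, map_mul, map_one, σ_q, σ_z, σ_S7, Int.reduceAdd, Int.reduceNeg]
    ring
  -- The profile is rotated to `(1,3,0)`, so that its zero stands last as in `H_succ_succ_zero`.
  have h301 : H ![1, 3, 0] = σ (H ![0, 4, 0]) + σ (H ![1, 2, 1]) -
      (1 - z * q) * σ (σ (H ![0, 3, 1])) :=
    H_succ_succ_zero 0 2
  rw [r130, r040, r121, r031] at h301
  have t301 : S7 1 0 - q * (1 - z) * S7 2 1 = σ (S7 1 1) + σ (S7 0 0 - q * S7 1 1) -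
      (1 - z * q) * σ (σ (S7 0 1)) := by
    simp only [map_sub, map_mul, σ_q, σ_S7, Int.reduceAdd]
    ring
  have h211 : H ![2, 1, 1] = σ (H ![1, 2, 1]) + σ (H ![2, 0, 2]) + σ (H ![3, 1, 0]) -
      (1 - z * q) * (σ (σ (H ![1, 1, 2])) + σ (σ (H ![3, 0, 1])) +
        σ (σ (H ![2, 2, 0]))) +
      (1 - z * q) * ((1 - z * q * q) * σ (σ (σ (H ![2, 1, 1])))) :=
    H_succ_succ_succ 1 0 0
  rw [r121, r202, r112] at h211
  have t211 : S7 0 0 - q * S7 1 1 = σ (S7 0 0 - q * S7 1 1) + σ (S7 (-1) 1 - z * S7 1 0) + σ (S7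
      0 1) -
      (1 - z * q) * (σ (σ (S7 0 0 - q * S7 1 1)) + σ (σ (S7 1 0 - q * (1 - z) * S7 2 1)) +
        σ (σ (S7 (-1) 1 - z * S7 1 0))) +
      (1 - z * q) * ((1 - z * q * q) * σ (σ (σ (S7 0 0 - q * S7 1 1)))) := by
    simp only [map_sub, map_mul, map_one, σ_q, σ_z, σ_S7, Int.reduceAdd, Int.reduceNeg]
    linear_combination S7_funeq₂₁₁
  have h220 : H ![2, 2, 0] = σ (H ![1, 3, 0]) + σ (H ![2, 1, 1]) -
      (1 - z * q) * σ (σ (H ![1, 2, 1])) :=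
    H_succ_succ_zero 1 1
  rw [r130, r121] at h220
  have t220 : S7 (-1) 1 - z * S7 1 0 = σ (S7 1 0 - q * (1 - z) * S7 2 1) + σ (S7 0 0 - q * S7 1
      1) -
      (1 - z * q) * σ (σ (S7 0 0 - q * S7 1 1)) := by
    simp only [map_sub, map_mul, map_one, σ_q, σ_z, σ_S7, Int.reduceAdd]
    linear_combination S7_funeq₂₂₀
  obtain ⟨D, hD⟩ : ∃ D : Fin 5 → ZQ, D = ![H ![4, 0, 0] - S7 1 1, H ![3, 1, 0] - S7 0 1, H ![3,
      0, 1] - (S7 1 0 - q * (1 - z) * S7 2 1), H ![2, 1, 1] - (S7 0 0 - q * S7 1 1), H ![2, 2, 0]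
      - (S7 (-1) 1 - z * S7 1 0)] := ⟨_, rfl⟩
  have d0 : D 0 = H ![4, 0, 0] - S7 1 1 := by rw [hD]; rfl
  have d1 : D 1 = H ![3, 1, 0] - S7 0 1 := by rw [hD]; rfl
  have d2 : D 2 = H ![3, 0, 1] - (S7 1 0 - q * (1 - z) * S7 2 1) := by rw [hD]; rfl
  have d3 : D 3 = H ![2, 1, 1] - (S7 0 0 - q * S7 1 1) := by rw [hD]; rfl
  have d4 : D 4 = H ![2, 2, 0] - (S7 (-1) 1 - z * S7 1 0) := by rw [hD]; rfl
  have b0 : ShiftSpan D (σ (H ![4, 0, 0] - S7 1 1)) := d0 ▸ .base 0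
  have b1 : ShiftSpan D (σ (H ![3, 1, 0] - S7 0 1)) := d1 ▸ .base 1
  have b2 : ShiftSpan D (σ (H ![3, 0, 1] - (S7 1 0 - q * (1 - z) * S7 2 1))) := d2 ▸ .base 2
  have b3 : ShiftSpan D (σ (H ![2, 1, 1] - (S7 0 0 - q * S7 1 1))) := d3 ▸ .base 3
  have b4 : ShiftSpan D (σ (H ![2, 2, 0] - (S7 (-1) 1 - z * S7 1 0))) := d4 ▸ .base 4
  have key := eq_zero_of_shiftSpan D ?_ ?_
  · exact ⟨sub_eq_zero.mp (d0 ▸ key 0), sub_eq_zero.mp (d1 ▸ key 1), sub_eq_zero.mp (d2 ▸ key 2),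
      sub_eq_zero.mp (d3 ▸ key 3), sub_eq_zero.mp (d4 ▸ key 4)⟩
  · simp only [Fin.forall_fin_succ, IsEmpty.forall_iff, and_true]
    refine ⟨?_, ?_, ?_, ?_, ?_⟩
    · refine (congrArg _ d0).trans (coeff_zero_H_sub _ ?_)
      exact coeff_zero_S7_one _
    · refine (congrArg _ d1).trans (coeff_zero_H_sub _ ?_)
      exact coeff_zero_S7_one _
    · refine (congrArg _ d2).trans (coeff_zero_H_sub _ ?_)
      rw [map_sub, coeff_zero_q_mul_one_sub_z_mul, coeff_zero_S7_zero, coeff_zero_S7_one]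
      ring
    · refine (congrArg _ d3).trans (coeff_zero_H_sub _ ?_)
      rw [map_sub, coeff_q_mul, coeff_zero_S7_zero, coeff_zero_S7_one]
      ring
    · refine (congrArg _ d4).trans (coeff_zero_H_sub _ ?_)
      rw [map_sub, coeff_z_mul_zero, coeff_zero_S7_one, sub_zero]
  · simp only [Fin.forall_fin_succ, IsEmpty.forall_iff, and_true]
    refine ⟨?_, ?_, ?_, ?_, ?_⟩
    · exact d0 ▸ shiftSpan_sub_of_eq₁ h400 t400 b1
    · exact d1 ▸ shiftSpan_sub_of_eq₂ h310 t310 b4 b2 b3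
    · exact d2 ▸ shiftSpan_sub_of_eq₂ h301 t301 b0 b3 b1
    · exact d3 ▸ shiftSpan_sub_of_eq₃ h211 t211 b3 b4 b1 b3 b2 b4 b3
    · exact d4 ▸ shiftSpan_sub_of_eq₂ h220 t220 b2 b3 b3

/-- The class of `(2,2,1)` is represented by the expression listed for `(2,1,2)`. The equations for
`(5,0,0)`, `(4,0,1)` and `(3,0,2)` hold identically; the other four need relations between the sums.
-/
theorem H_eq_S8 :
    H ![5, 0, 0] = S8 1 1 1 1 ∧
    H ![4, 1, 0] = S8 0 1 1 1 ∧
    H ![3, 2, 0] = S8 0 0 1 1 ∧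
    H ![3, 1, 1] = S8 0 1 0 1 - q * S8 1 1 1 1 ∧
    H ![2, 2, 1] = S8 0 1 0 0 - q * S8 1 1 0 1 ∧
    H ![4, 0, 1] = S8 1 1 0 1 - q * (1 - z) * S8 2 1 1 1 ∧
    H ![3, 0, 2] = S8 1 1 0 0 - q * (1 - z) * S8 2 1 0 1 := by
  have r041 : H ![0, 4, 1] = H ![4, 1, 0] := (H_rotate 0 4 1).symm
  have r050 : H ![0, 5, 0] = H ![5, 0, 0] := (H_rotate 0 5 0).symm
  have r122 : H ![1, 2, 2] = H ![2, 2, 1] := (H_rotate 1 2 2).symm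
  have r131 : H ![1, 3, 1] = H ![3, 1, 1] := (H_rotate 1 3 1).symm
  have r140 : H ![1, 4, 0] = H ![4, 0, 1] := (H_rotate 1 4 0).symm
  have r212 : H ![2, 1, 2] = H ![2, 2, 1] := H_rotate 2 2 1
  have r230 : H ![2, 3, 0] = H ![3, 0, 2] := (H_rotate 2 3 0).symm
  have h500 : H ![5, 0, 0] = σ (H ![4, 1, 0]) :=
    H_succ_zero_zero 4
  have t500 : S8 1 1 1 1 = σ (S8 0 1 1 1) := by
    simp only [σ_S8, Int.reduceAdd]
  have h410 : H ![4, 1, 0] = σ (H ![3, 2, 0]) + σ (H ![4, 0, 1]) -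
      (1 - z * q) * σ (σ (H ![3, 1, 1])) :=
    H_succ_succ_zero 3 0
  have t410 : S8 0 1 1 1 = σ (S8 0 0 1 1) + σ (S8 1 1 0 1 - q * (1 - z) * S8 2 1 1 1) -
      (1 - z * q) * σ (σ (S8 0 1 0 1 - q * S8 1 1 1 1)) := by
    simp only [map_sub, map_mul, map_one, σ_q, σ_z, σ_S8, Int.reduceAdd]
    linear_combination S8_funeq₄₁₀
  have h320 : H ![3, 2, 0] = σ (H ![2, 3, 0]) + σ (H ![3, 1, 1]) -
      (1 - z * q) * σ (σ (H ![2, 2, 1])) :=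
    H_succ_succ_zero 2 1
  rw [r230] at h320
  have t320 : S8 0 0 1 1 = σ (S8 1 1 0 0 - q * (1 - z) * S8 2 1 0 1) + σ (S8 0 1 0 1 - q * S8 1 1
      1 1) -
      (1 - z * q) * σ (σ (S8 0 1 0 0 - q * S8 1 1 0 1)) := by
    simp only [map_sub, map_mul, map_one, σ_q, σ_z, σ_S8, Int.reduceAdd]
    linear_combination S8_funeq₃₂₀
  have h311 : H ![3, 1, 1] = σ (H ![2, 2, 1]) + σ (H ![3, 0, 2]) + σ (H ![4, 1, 0]) -
      (1 - z * q) * (σ (σ (H ![2, 1, 2])) + σ (σ (H ![4, 0, 1])) +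
        σ (σ (H ![3, 2, 0]))) +
      (1 - z * q) * ((1 - z * q * q) * σ (σ (σ (H ![3, 1, 1])))) :=
    H_succ_succ_succ 2 0 0
  rw [r212] at h311
  have t311 : S8 0 1 0 1 - q * S8 1 1 1 1 = σ (S8 0 1 0 0 - q * S8 1 1 0 1) + σ (S8 1 1 0 0 - q *
      (1 - z) * S8 2 1 0 1) + σ (S8 0 1 1 1) -
      (1 - z * q) * (σ (σ (S8 0 1 0 0 - q * S8 1 1 0 1)) + σ (σ (S8 1 1 0 1 - q * (1 - z) * S8 2
          1 1 1)) +
        σ (σ (S8 0 0 1 1))) +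
      (1 - z * q) * ((1 - z * q * q) * σ (σ (σ (S8 0 1 0 1 - q * S8 1 1 1 1)))) := by
    simp only [map_sub, map_mul, map_one, σ_q, σ_z, σ_S8, Int.reduceAdd]
    linear_combination S8_funeq₃₁₁
  have h221 : H ![2, 2, 1] = σ (H ![1, 3, 1]) + σ (H ![2, 1, 2]) + σ (H ![3, 2, 0]) -
      (1 - z * q) * (σ (σ (H ![1, 2, 2])) + σ (σ (H ![3, 1, 1])) +
        σ (σ (H ![2, 3, 0]))) +
      (1 - z * q) * ((1 - z * q * q) * σ (σ (σ (H ![2, 2, 1])))) :=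
    H_succ_succ_succ 1 1 0
  rw [r131, r212, r122, r230] at h221
  have t221 : S8 0 1 0 0 - q * S8 1 1 0 1 = σ (S8 0 1 0 1 - q * S8 1 1 1 1) + σ (S8 0 1 0 0 - q *
      S8 1 1 0 1) + σ (S8 0 0 1 1) -
      (1 - z * q) * (σ (σ (S8 0 1 0 0 - q * S8 1 1 0 1)) + σ (σ (S8 0 1 0 1 - q * S8 1 1 1 1)) +
        σ (σ (S8 1 1 0 0 - q * (1 - z) * S8 2 1 0 1))) +
      (1 - z * q) * ((1 - z * q * q) * σ (σ (σ (S8 0 1 0 0 - q * S8 1 1 0 1)))) := by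
    simp only [map_sub, map_mul, map_one, σ_q, σ_z, σ_S8, Int.reduceAdd]
    linear_combination S8_funeq₂₁₂
  have h401 : H ![1, 4, 0] = σ (H ![0, 5, 0]) + σ (H ![1, 3, 1]) -
      (1 - z * q) * σ (σ (H ![0, 4, 1])) :=
    H_succ_succ_zero 0 3
  rw [r140, r050, r131, r041] at h401
  have t401 : S8 1 1 0 1 - q * (1 - z) * S8 2 1 1 1 = σ (S8 1 1 1 1) + σ (S8 0 1 0 1 - q * S8 1 1
      1 1) -
      (1 - z * q) * σ (σ (S8 0 1 1 1)) := by
    simp only [map_sub, map_mul, σ_q, σ_S8, Int.reduceAdd]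
    ring
  have h302 : H ![2, 3, 0] = σ (H ![1, 4, 0]) + σ (H ![2, 2, 1]) -
      (1 - z * q) * σ (σ (H ![1, 3, 1])) :=
    H_succ_succ_zero 1 2
  rw [r230, r140, r131] at h302
  have t302 : S8 1 1 0 0 - q * (1 - z) * S8 2 1 0 1 = σ (S8 1 1 0 1 - q * (1 - z) * S8 2 1 1 1) +
      σ (S8 0 1 0 0 - q * S8 1 1 0 1) -
      (1 - z * q) * σ (σ (S8 0 1 0 1 - q * S8 1 1 1 1)) := by
    simp only [map_sub, map_mul, map_one, σ_q, σ_z, σ_S8, Int.reduceAdd]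
    ring
  obtain ⟨D, hD⟩ : ∃ D : Fin 7 → ZQ, D = ![H ![5, 0, 0] - S8 1 1 1 1, H ![4, 1, 0] - S8 0 1 1 1,
      H ![3, 2, 0] - S8 0 0 1 1, H ![3, 1, 1] - (S8 0 1 0 1 - q * S8 1 1 1 1), H ![2, 2, 1] - (S8
      0 1 0 0 - q * S8 1 1 0 1), H ![4, 0, 1] - (S8 1 1 0 1 - q * (1 - z) * S8 2 1 1 1), H ![3,
      0, 2] - (S8 1 1 0 0 - q * (1 - z) * S8 2 1 0 1)] := ⟨_, rfl⟩
  have d0 : D 0 = H ![5, 0, 0] - S8 1 1 1 1 := by rw [hD]; rfl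
  have d1 : D 1 = H ![4, 1, 0] - S8 0 1 1 1 := by rw [hD]; rfl
  have d2 : D 2 = H ![3, 2, 0] - S8 0 0 1 1 := by rw [hD]; rfl
  have d3 : D 3 = H ![3, 1, 1] - (S8 0 1 0 1 - q * S8 1 1 1 1) := by rw [hD]; rfl
  have d4 : D 4 = H ![2, 2, 1] - (S8 0 1 0 0 - q * S8 1 1 0 1) := by rw [hD]; rfl
  have d5 : D 5 = H ![4, 0, 1] - (S8 1 1 0 1 - q * (1 - z) * S8 2 1 1 1) := by rw [hD]; rfl
  have d6 : D 6 = H ![3, 0, 2] - (S8 1 1 0 0 - q * (1 - z) * S8 2 1 0 1) := by rw [hD]; rfl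
  have b0 : ShiftSpan D (σ (H ![5, 0, 0] - S8 1 1 1 1)) := d0 ▸ .base 0
  have b1 : ShiftSpan D (σ (H ![4, 1, 0] - S8 0 1 1 1)) := d1 ▸ .base 1
  have b2 : ShiftSpan D (σ (H ![3, 2, 0] - S8 0 0 1 1)) := d2 ▸ .base 2
  have b3 : ShiftSpan D (σ (H ![3, 1, 1] - (S8 0 1 0 1 - q * S8 1 1 1 1))) := d3 ▸ .base 3
  have b4 : ShiftSpan D (σ (H ![2, 2, 1] - (S8 0 1 0 0 - q * S8 1 1 0 1))) := d4 ▸ .base 4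
  have b5 : ShiftSpan D (σ (H ![4, 0, 1] - (S8 1 1 0 1 - q * (1 - z) * S8 2 1 1 1))) := d5 ▸
      .base 5
  have b6 : ShiftSpan D (σ (H ![3, 0, 2] - (S8 1 1 0 0 - q * (1 - z) * S8 2 1 0 1))) := d6 ▸
      .base 6
  have key := eq_zero_of_shiftSpan D ?_ ?_
  · exact ⟨sub_eq_zero.mp (d0 ▸ key 0), sub_eq_zero.mp (d1 ▸ key 1), sub_eq_zero.mp (d2 ▸ key 2),
      sub_eq_zero.mp (d3 ▸ key 3), sub_eq_zero.mp (d4 ▸ key 4), sub_eq_zero.mp (d5 ▸ key 5),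
      sub_eq_zero.mp (d6 ▸ key 6)⟩
  · simp only [Fin.forall_fin_succ, IsEmpty.forall_iff, and_true]
    refine ⟨?_, ?_, ?_, ?_, ?_, ?_, ?_⟩
    · refine (congrArg _ d0).trans (coeff_zero_H_sub _ ?_)
      exact coeff_zero_S8_one_one _ _
    · refine (congrArg _ d1).trans (coeff_zero_H_sub _ ?_)
      exact coeff_zero_S8_one_one _ _
    · refine (congrArg _ d2).trans (coeff_zero_H_sub _ ?_)
      exact coeff_zero_S8_one_one _ _
    · refine (congrArg _ d3).trans (coeff_zero_H_sub _ ?_)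
      rw [map_sub, coeff_q_mul, coeff_zero_S8_zero_one, coeff_zero_S8_one_one]
      ring
    · refine (congrArg _ d4).trans (coeff_zero_H_sub _ ?_)
      rw [map_sub, coeff_q_mul, coeff_zero_S8_zero_zero, coeff_zero_S8_zero_one]
      ring
    · refine (congrArg _ d5).trans (coeff_zero_H_sub _ ?_)
      rw [map_sub, coeff_zero_q_mul_one_sub_z_mul, coeff_zero_S8_zero_one, coeff_zero_S8_one_one]
      ring
    · refine (congrArg _ d6).trans (coeff_zero_H_sub _ ?_)
      rw [map_sub, coeff_zero_q_mul_one_sub_z_mul, coeff_zero_S8_zero_zero,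
          coeff_zero_S8_zero_one]
      ring
  · simp only [Fin.forall_fin_succ, IsEmpty.forall_iff, and_true]
    refine ⟨?_, ?_, ?_, ?_, ?_, ?_, ?_⟩
    · exact d0 ▸ shiftSpan_sub_of_eq₁ h500 t500 b1
    · exact d1 ▸ shiftSpan_sub_of_eq₂ h410 t410 b2 b5 b3
    · exact d2 ▸ shiftSpan_sub_of_eq₂ h320 t320 b6 b3 b4
    · exact d3 ▸ shiftSpan_sub_of_eq₃ h311 t311 b4 b6 b1 b4 b5 b2 b3
    · exact d4 ▸ shiftSpan_sub_of_eq₃ h221 t221 b3 b4 b2 b4 b3 b6 b4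
    · exact d5 ▸ shiftSpan_sub_of_eq₂ h401 t401 b0 b3 b1
    · exact d6 ▸ shiftSpan_sub_of_eq₂ h302 t302 b5 b4 b3

end CylPart

theorem mainTheorem7 :
    -- compositions of 2
    (∀ j, H (rot ![2, 0, 0] j) = S5 1 1) ∧
    (∀ j, H (rot ![1, 1, 0] j) = S5 0 1) ∧
    (∀ j, H (rot ![1, 0, 1] j) = S5 1 0 - q * (1 - z) * S5 2 1) ∧
    -- compositions of 4
    (∀ j, H (rot ![4, 0, 0] j) = S7 1 1) ∧
    (∀ j, H (rot ![3, 1, 0] j) = S7 0 1) ∧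
    (∀ j, H (rot ![3, 0, 1] j) = S7 1 0 - q * (1 - z) * S7 2 1) ∧
    (∀ j, H (rot ![2, 1, 1] j) = S7 0 0 - q * S7 1 1) ∧
    (∀ j, H (rot ![2, 2, 0] j) = S7 (-1) 1 - z * S7 1 0) ∧
    -- compositions of 5
    (∀ j, H (rot ![5, 0, 0] j) = S8 1 1 1 1) ∧
    (∀ j, H (rot ![4, 1, 0] j) = S8 0 1 1 1) ∧
    (∀ j, H (rot ![3, 2, 0] j) = S8 0 0 1 1) ∧
    (∀ j, H (rot ![3, 1, 1] j) = S8 0 1 0 1 - q * S8 1 1 1 1) ∧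
    (∀ j, H (rot ![2, 2, 1] j) = S8 0 0 0 1 - q * S8 0 1 1 1) ∧
    (∀ j, H (rot ![2, 1, 2] j) = S8 0 1 0 0 - q * S8 1 1 0 1) ∧
    (∀ j, H (rot ![4, 0, 1] j) = S8 1 1 0 1 - q * (1 - z) * S8 2 1 1 1) ∧
    (∀ j, H (rot ![3, 0, 2] j) = S8 1 1 0 0 - q * (1 - z) * S8 2 1 0 1) := by
  obtain ⟨h200, h110⟩ := H_eq_S5
  obtain ⟨h400, h310, h301, h211, h220⟩ := H_eq_S7
  obtain ⟨h500, h410, h320, h311, h221, h401, h302⟩ := H_eq_S8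
  simp only [H_rot]
  refine ⟨fun _ => h200, fun _ => h110, fun _ => ?_, fun _ => h400, fun _ => h310, fun _ => h301,
    fun _ => h211, fun _ => h220, fun _ => h500, fun _ => h410, fun _ => h320, fun _ => h311,
    fun _ => ?_, fun _ => ?_, fun _ => h401, fun _ => h302⟩
  · rw [H_rotate 1 1 0, h110]
    linear_combination S5_eq₁₀₁
  -- The system was solved with the expression for `(2,1,2)`; the one for `(2,2,1)` follows from
  -- `S8_eq₂₁₂`.
  · rw [h221]
    linear_combination -S8_eq₂₁₂
  · rw [H_rotate 2 2 1, h221]
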